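/- All graphs are finite and may have loops and multiple edges. Let $G$ be a connected plane graph, that is, a connected graph with a fixed drawing in the plane: distinct vertices are drawn as distinct points, every edge is drawn as a continuous curve without self-crossings that joins its ends (a closed curve if the edge is a loop), and an edge meets the vertices and the other edges only at its ends. For a spanning tree $T$ of $G$ and an edge $e$ of $T$ let $A_e,B_e$ be the vertex sets of the two components of $T-e$, let $e_G(A_e,B_e)$ be the number of edges of $G$ with one end in $A_e$ and the other in $B_e$, and put $$\mathrm{ec}(G:T)=\max_{e\in E(T)}e_G(A_e,B_e),\qquad s(G)=\min\{\mathrm{ec}(G:T): T \text{ is a spanning tree of } G\}$$ (the first maximum is $0$ if $T$ has no edges). The faces of $G$ are the connected components of the complement of the drawing; the exterior face $O$ is the unbounded one, the other faces are called interior. The dual graph $G^*$ has the faces of $G$ as its vertices and, for every edge $e$ of $G$, one edge $e^*$ which joins the faces on the two sides of $e$ (it is a loop if these coincide). An edge is an outer edge if it occurs in the boundary of $O$ and in the boundary of an interior face. For an outer edge $e$ and an interior face $F$ let $i(F,e)$ be the length of a shortest path in $G^*$ from $O$ to $F$ whose first edge is $e^*$ ($\infty$ if there is no such path). The absolute index of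 an interior face $F$ is $i(F)=\min_e i(F,e)$, the minimum being over all outer edges $e$; for the exterior face put $i(O)=0$. Then all numbers $i(F)$ with $F$ sharing a boundary edge with another face are finite, and $$s(G)\le \max\bigl(i(F)+i(\widetilde F)\bigr)+1,$$ where the maximum is over all pairs $F,\widetilde F$ of distinct faces (the exterior face included) which have a common edge in their boundaries, and is read as $0$ if there is no such pair, that is, if $O$ is the only face. -/

import Mathlib

open scoped Graph unitInterval

noncomputable section

namespace Graph

variable {α β : Type*}

/-! ### Connectedness, trees and spanning tree congestion of (multi)graphs -/

/-- `x` and `y` lie in the same component of `G`. -/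
def Reachable (G : Graph α β) (x y : α) : Prop :=
  x ∈ V(G) ∧ Relation.ReflTransGen G.Adj x y

/-- A graph is connected if it has a vertex and any two vertices are joined by a walk. -/
def IsConnected (G : Graph α β) : Prop :=
  V(G).Nonempty ∧ ∀ x ∈ V(G), ∀ y ∈ V(G), G.Reachable x y

/-- `v 0, f 0, v 1, f 1, …, f (n - 1), v n = v 0` is a cycle of length `n ≥ 1` in `G`: its
vertices `v 0, …, v (n - 1)` are distinct and so are its edges. Loops are cycles of length `1`,
pairs of parallel edges are cycles of length `2`. -/
structure IsCycle (G : Graph α β) (n : ℕ) (v : ℕ → α) (f : ℕ → β) : Prop where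
  pos : 0 < n
  isLink : ∀ k < n, G.IsLink (f k) (v k) (v (k + 1))
  closed : v n = v 0
  vertex_injOn : Set.InjOn v (Set.Iio n)
  edge_injOn : Set.InjOn f (Set.Iio n)

/-- A tree is a connected graph without cycles. -/
def IsTree (T : Graph α β) : Prop :=
  T.IsConnected ∧ ∀ n v f, ¬ T.IsCycle n v f

/-- `T` is a spanning tree of `G`. -/
def IsSpanningTree (T G : Graph α β) : Prop :=
  T ≤s G ∧ T.IsTree

/-- The vertex set of the component of `x` in `G`. -/
def component (G : Graph α β) (x : α) : Set α := {y | G.Reachable x y}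

/-- The edges of `G` with one end in `A_e` and the other end in `B_e`, where `A_e` and `B_e` are
the components, in `T - e`, of the two ends of the edge `e` of `T`. -/
def congestionSet (G T : Graph α β) (e : β) : Set β :=
  {g | ∃ x y, T.IsLink e x y ∧ ∃ a ∈ (T.deleteEdges {e}).component x,
    ∃ b ∈ (T.deleteEdges {e}).component y, G.IsLink g a b}

/-- The edge congestion `ec(G : T)`: the maximum over the edges `e` of `T` of the number
`e_G(A_e, B_e)`. -/
def edgeCongestion (G T : Graph α β) : ℕ∞ :=
  ⨆ e ∈ E(T), (G.congestionSet T e).encard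

/-- The spanning tree congestion `s(G)`: the minimum of `ec(G : T)` over the spanning trees. -/
def spanningTreeCongestion (G : Graph α β) : ℕ∞ :=
  ⨅ (T : Graph α β) (_ : T.IsSpanningTree G), G.edgeCongestion T

/-- `G` contains a path (without repeated vertices) of length `n ≥ 1` from `x` to `y` whose
first edge is `e`. -/
def HasPathWithFirstEdge (G : Graph α β) (x y : α) (e : β) (n : ℕ) : Prop :=
  ∃ (v : ℕ → α) (f : ℕ → β), 0 < n ∧ v 0 = x ∧ v n = y ∧ f 0 = e ∧
    Set.InjOn v (Set.Iic n) ∧ ∀ k < n, G.IsLink (f k) (v k) (v (k + 1))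

/-! ### Plane graphs -/

/-- A drawing of the graph `G` in the plane, the latter taken to be `ℂ`. Distinct vertices are
drawn as distinct points; every edge is drawn as a continuous curve which joins the points of its
two ends, has no self-crossings, and meets the rest of the drawing only at its ends. The curve of a
loop is closed. -/
structure PlaneDrawing (G : Graph α β) where
  /-- The position of a vertex. -/
  point : α → ℂ
  /-- The parametrized curve that represents an edge. -/
  curve : β → I → ℂ
  point_injOn : Set.InjOn point V(G)
  curve_continuous : ∀ e ∈ E(G), Continuous (curve e)
  curve_ends : ∀ e ∈ E(G), ∃ x y, G.IsLink e x y ∧ curve e 0 = point x ∧ curve e 1 = point y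
  curve_injOn : ∀ e ∈ E(G), Set.InjOn (curve e) (Set.Ioo 0 1)
  curve_ne_point : ∀ e ∈ E(G), ∀ t ∈ Set.Ioo (0 : I) 1, ∀ x ∈ V(G), curve e t ≠ point x
  curve_disjoint : ∀ e ∈ E(G), ∀ e' ∈ E(G), e ≠ e' →
    Disjoint (curve e '' Set.Ioo 0 1) (curve e' '' Set.Ioo 0 1)

namespace PlaneDrawing

variable {G : Graph α β} (D : PlaneDrawing G)

/-- The set of points of the plane occupied by the drawing. -/
def support : Set ℂ := D.point '' V(G) ∪ ⋃ e ∈ E(G), Set.range (D.curve e)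

/-- The faces are the connected components of the complement of the drawing. -/
def IsFace (F : Set ℂ) : Prop :=
  ∃ z ∈ D.supportᶜ, F = connectedComponentIn D.supportᶜ z

/-- The exterior face is the unbounded one. -/
def IsExteriorFace (F : Set ℂ) : Prop := D.IsFace F ∧ ¬ Bornology.IsBounded F

/-- The interior faces are the bounded ones. -/
def IsInteriorFace (F : Set ℂ) : Prop := D.IsFace F ∧ Bornology.IsBounded F

/-- The edge `e` occurs in the boundary of `F`. -/
def IsBoundaryEdge (e : β) (F : Set ℂ) : Prop :=
  e ∈ E(G) ∧ Set.range (D.curve e) ⊆ frontier F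

/-- The dual graph `G*`. Its vertices are the faces, and the edge `e*` (labelled by `e` itself)
joins the faces on the two sides of `e`: these are `F` and `F'` if the faces having `e` in their
boundary are exactly `F` and `F'`. If this is a single face, `e*` is a loop. -/
def dual : Graph (Set ℂ) β where
  vertexSet := {F | D.IsFace F}
  IsLink e F F' := e ∈ E(G) ∧ D.IsFace F ∧ D.IsFace F' ∧
    ∀ H, D.IsFace H → (D.IsBoundaryEdge e H ↔ H = F ∨ H = F')
  isLink_symm := fun _ _ => ⟨fun _ _ h =>
    ⟨h.1, h.2.2.1, h.2.1, fun H hH => (h.2.2.2 H hH).trans or_comm⟩⟩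
  eq_or_eq_of_isLink_of_isLink := fun _ F _ _ _ h h' =>
    (h'.2.2.2 F h.2.1).1 ((h.2.2.2 F h.2.1).2 (Or.inl rfl))
  left_mem_of_isLink := fun _ _ _ h => h.2.1

/-- An outer edge occurs in the boundary of the exterior face and of an interior face. -/
def IsOuterEdge (e : β) : Prop :=
  (∃ O, D.IsExteriorFace O ∧ D.IsBoundaryEdge e O) ∧
    ∃ F, D.IsInteriorFace F ∧ D.IsBoundaryEdge e F

/-- The index `i(F, e)`: the length of a shortest path in `G*` which joins the exterior face
with `F` and has `e*` as its first edge (`⊤` if there is no such path). -/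
def index (F : Set ℂ) (e : β) : ℕ∞ :=
  ⨅ (O : Set ℂ) (_ : D.IsExteriorFace O) (n : ℕ) (_ : D.dual.HasPathWithFirstEdge O F e n), (n : ℕ∞)

open Classical in
/-- The absolute index `i(F)`: the minimum of `i(F, e)` over the outer edges `e` if `F` is an
interior face, and `0` if `F` is the exterior face. -/
def absoluteIndex (F : Set ℂ) : ℕ∞ :=
  if D.IsExteriorFace F then 0 else ⨅ (e : β) (_ : D.IsOuterEdge e), D.index F e

/-- `F` and `F'` are distinct faces which have a common edge in their boundaries. -/
def AreAdjacentFaces (F F' : Set ℂ) : Prop :=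
  D.IsFace F ∧ D.IsFace F' ∧ F ≠ F' ∧ ∃ e, D.IsBoundaryEdge e F ∧ D.IsBoundaryEdge e F'

/-- The maximum of `i(F) + i(F')` over all pairs of faces which have a common edge in their
boundaries (and `0` if there is no such pair, that is, if there is only one face). -/
def maxIndexSum : ℕ∞ :=
  ⨆ (F : Set ℂ) (F' : Set ℂ) (_ : D.AreAdjacentFaces F F'), (D.absoluteIndex F + D.absoluteIndex F')

end PlaneDrawing

end Graph

end

/-! The proof is tree–cotree duality. Take a breadth first search tree of the dual graph rooted at
the exterior face O, and let T consist of the edges of G whose duals lie outside it. Then T is a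
spanning tree of G. Let e be an edge of T whose dual joins F and F'. Every other edge across the
fundamental cut of e is a dual tree edge `up H` such that the subtree below H contains exactly one
of F and F'; so H is an ancestor, other than O, of F or of F'. A face has at most as many such
ancestors as its distance from O. This distance is its absolute index, since a shortest path from O
starts across an outer edge. Hence the cut has at most i(F) + i(F') + 1 edges.

The facts about T come from two topological statements on the drawing of an edge set S. If S is
acyclic, the drawing of S does not separate the plane (`isPreconnected_compl_supportOn`), so all
faces are linked by crossing edges outside S (`forall_face_mem_of_isPreconnected`). If S contains a
cycle, that cycle separates the plane (`not_isPreconnected_compl_simpleClosedCurve`). The second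
makes T acyclic, because the faces are linked through the dual tree. The first, applied to T with an
edge added between two of its components, shows that T spans; applied to T - e + g, it describes the
fundamental cuts.

Both rest on Eilenberg's criterion: points p, q off a compact set K lie in one component of its
complement exactly if (z - p)/(z - q) has a continuous logarithm on K (`hasLogOn_of_isPreconnected`,
`connectedComponentIn_eq_of_hasLogOn`). On the drawing of a forest, lifts along the edges can always
be adjusted at the vertices to fit together. Over a single edge the only obstruction is one integer,
which is why no edge bounds three faces (`eq_of_three_isBoundaryEdge`). -/

noncomputable section

/-! ### Continuous logarithms and the complement of a compact plane set -/

namespace PlaneTopology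

open Set Filter Topology Complex

/-- `f` has a continuous logarithm on `K`. -/
def HasLogOn (f : ℂ → ℂ) (K : Set ℂ) : Prop :=
  ∃ g : ℂ → ℂ, ContinuousOn g K ∧ ∀ z ∈ K, exp (g z) = f z

theorem exists_continuous_log {A : Type*} [TopologicalSpace A] [SimplyConnectedSpace A]
    [LocallyPathConnectedSpace A] {f : A → ℂ} (hf : Continuous f) (h0 : ∀ a, f a ≠ 0)
    (a₀ : A) {c : ℂ} (hc : exp c = f a₀) :
    ∃ F : A → ℂ, Continuous F ∧ F a₀ = c ∧ ∀ a, exp (F a) = f a := by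
  obtain ⟨F, ⟨h1, h2⟩, -⟩ := isCoveringMapOn_exp.existsUnique_continuousMap_lifts
    ⟨f, hf⟩ (a₀ := a₀) (e₀ := c) hc (by simpa using h0)
  exact ⟨F, F.continuous, h1, fun a => congrFun h2 a⟩

theorem exists_continuous_log_unitInterval {f : I → ℂ} (hf : Continuous f) (h0 : ∀ a, f a ≠ 0)
    (a₀ : I) {c : ℂ} (hc : exp c = f a₀) :
    ∃ F : I → ℂ, Continuous F ∧ F a₀ = c ∧ ∀ a, exp (F a) = f a := by
  obtain ⟨F, h1, h2, h3⟩ := exists_continuous_log (A := ℝ)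
    (f := fun t => f (projIcc 0 1 zero_le_one t)) (hf.comp continuous_projIcc)
    (fun a => h0 _) (a₀ : ℝ) (c := c) (by simpa using hc)
  exact ⟨fun t => F t, h1.comp continuous_subtype_val, h2, fun a => by simpa using h3 a⟩

theorem HasLogOn.mono {f : ℂ → ℂ} {K L : Set ℂ} (h : HasLogOn f K) (hL : L ⊆ K) :
    HasLogOn f L := by
  obtain ⟨g, hg, he⟩ := h
  exact ⟨g, hg.mono hL, fun z hz => he z (hL hz)⟩

theorem HasLogOn.mul {f f' : ℂ → ℂ} {K : Set ℂ} (h : HasLogOn f K) (h' : HasLogOn f' K) :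
    HasLogOn (fun z => f z * f' z) K := by
  obtain ⟨g, hg, he⟩ := h
  obtain ⟨g', hg', he'⟩ := h'
  exact ⟨fun z => g z + g' z, hg.add hg', fun z hz => by rw [exp_add, he z hz, he' z hz]⟩

theorem HasLogOn.inv {f : ℂ → ℂ} {K : Set ℂ} (h : HasLogOn f K) :
    HasLogOn (fun z => (f z)⁻¹) K := by
  obtain ⟨g, hg, he⟩ := h
  exact ⟨fun z => - g z, hg.neg, fun z hz => by rw [exp_neg, he z hz]⟩

theorem HasLogOn.congr {f f' : ℂ → ℂ} {K : Set ℂ} (h : HasLogOn f K) (h' : ∀ z ∈ K, f z = f' z) :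
    HasLogOn f' K := by
  obtain ⟨g, hg, he⟩ := h
  exact ⟨g, hg, fun z hz => by rw [he z hz, h' z hz]⟩

/-- Two points that are joined by a connected set off the compact set `K` cannot be told apart by
logarithms on `K`. -/
theorem hasLogOn_of_isPreconnected {K M : Set ℂ} (hK : IsCompact K) (hM : IsPreconnected M)
    (hd : Disjoint M K) {p q : ℂ} (hp : p ∈ M) (hq : q ∈ M) :
    HasLogOn (fun z => (z - p) / (z - q)) K := by
  have hne : ∀ x ∈ M, ∀ z ∈ K, z - x ≠ 0 := fun x hx z hz h =>
    disjoint_left.1 hd hx (by rwa [← sub_eq_zero.1 h])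
  refine hM.induction₂ (fun p q => HasLogOn (fun z => (z - p) / (z - q)) K) ?_ ?_ ?_ hp hq
  · intro x hx
    have hxK : x ∉ K := disjoint_left.1 hd hx
    obtain ⟨ε, hε, hb⟩ := Metric.isOpen_iff.1 hK.isClosed.isOpen_compl x hxK
    have : ∀ᶠ y in 𝓝[M] x, y ∈ Metric.ball x ε ∧ y ∈ M :=
      (eventually_nhdsWithin_of_eventually_nhds (Metric.ball_mem_nhds x hε)).and
        self_mem_nhdsWithin
    filter_upwards [this] with y ⟨hy, hyM⟩
    have key : HasLogOn (fun z => (z - y) / (z - x)) K := by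
      refine ⟨fun z => log ((z - y) / (z - x)), ?_, fun z hz => exp_log ?_⟩
      · refine ContinuousOn.clog ?_ ?_
        · exact ContinuousOn.div (by fun_prop) (by fun_prop) (hne x hx)
        · intro z hz
          have h1 := hne x hx z hz
          -- Since y is nearer to x than any point of K, the quotient stays in the open unit disc
          -- about 1, where the principal logarithm is continuous.
          have h2 : (z - y) / (z - x) = 1 + (x - y) / (z - x) := by field_simp; ring
          rw [h2]
          apply mem_slitPlane_of_norm_lt_one
          rw [norm_div, div_lt_one (norm_pos_iff.2 h1)]
          have h3 : ¬ dist z x < ε := fun h => hb h hz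
          rw [Metric.mem_ball, dist_comm, dist_eq_norm] at hy
          rw [dist_eq_norm] at h3
          linarith
      · exact div_ne_zero (hne y hyM z hz) (hne x hx z hz)
    exact key.inv.congr fun z hz => by rw [inv_div]
  · intro x y w hx hy hw h1 h2
    refine (h1.mul h2).congr fun z hz => ?_
    have := hne y hy z hz
    have := hne w hw z hz
    field_simp
  · intro x y hx hy h
    exact h.inv.congr fun z hz => by rw [inv_div]

/-- Winding number: after normalization at angle 0, the logarithm minus n·iθ is a continuous
function with values in 2πiℤ, hence constant, yet one full turn changes it by -2πi·n. -/
theorem eq_zero_of_hasLogOn_sphere {p : ℂ} {r : ℝ} (hr : 0 < r) {n : ℤ}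
    (h : HasLogOn (fun z => (z - p) ^ n) (Metric.sphere p r)) : n = 0 := by
  obtain ⟨g, hg, he⟩ := h
  let c : ℝ → ℂ := fun θ => p + r * exp (θ * Complex.I)
  have hc : Continuous c := by fun_prop
  have hcs : ∀ θ, c θ ∈ Metric.sphere p r := fun θ => by
    simp [c, norm_exp_ofReal_mul_I, abs_of_pos hr]
  have hgc : Continuous (fun θ => g (c θ)) :=
    hg.comp_continuous hc hcs
  have hr' : (r : ℂ) ≠ 0 := by exact_mod_cast hr.ne'
  let F : ℝ → ℂ := fun θ => (g (c θ) - g (c 0) - n * (θ * Complex.I)) / (2 * Real.pi * Complex.I)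
  have hF : Continuous F :=
    ((hgc.sub continuous_const).sub (by fun_prop : Continuous fun θ : ℝ =>
      (n : ℂ) * (θ * Complex.I))).div_const _
  have hpi : (2 * Real.pi * Complex.I : ℂ) ≠ 0 := two_pi_I_ne_zero
  have hint : ∀ θ, ∃ k : ℤ, F θ = k := by
    intro θ
    have h1 : exp (g (c θ) - g (c 0) - n * (θ * Complex.I)) = 1 := by
      rw [exp_sub, exp_sub, he _ (hcs _), he _ (hcs _), exp_int_mul]
      simp only [c, add_sub_cancel_left, ofReal_zero, zero_mul, exp_zero, mul_one, mul_zpow]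
      have := zpow_ne_zero n hr'
      have := zpow_ne_zero n (exp_ne_zero (θ * Complex.I))
      field_simp
    obtain ⟨k, hk⟩ := exp_eq_one_iff.1 h1
    refine ⟨k, ?_⟩
    simp only [F, hk]
    field_simp
  choose k hk using hint
  have hkc : Continuous k := by
    rw [Int.isClosedEmbedding_coe_real.continuous_iff]
    have : (fun θ => ((k θ : ℤ) : ℝ)) = fun θ => (F θ).re := by
      funext θ; simp [hk]
    exact (this ▸ (continuous_re.comp hF) : Continuous fun θ => ((k θ : ℤ) : ℝ))
  have hconst : k (2 * Real.pi) = k 0 := PreconnectedSpace.constant inferInstance hkc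
  have h0 : F 0 = 0 := by simp [F]
  have h1 : F (2 * Real.pi) = - n := by
    have : c (2 * Real.pi) = c 0 := by simp [c]
    simp only [F, this]
    push_cast
    field_simp
    ring
  rw [hk, hconst, ← hk, h0] at h1
  simpa using h1.symm

/-- A component of the complement of `K` that is bounded carries a nontrivial obstruction. -/
theorem eq_zero_of_hasLogOn_zpow {K U : Set ℂ} (hK : IsCompact K) (hU : IsOpen U)
    (hUb : Bornology.IsBounded U) (hUK : frontier U ⊆ K) {p : ℂ} (hp : p ∈ U) {n : ℤ}
    {f : ℂ → ℂ} (hf : ContinuousOn f (closure U)) (hf0 : ∀ z ∈ closure U, f z ≠ 0)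
    (hlog : HasLogOn (fun z => (z - p) ^ n * f z) K) : n = 0 := by
  classical
  obtain ⟨g, hg, he⟩ := hlog
  obtain ⟨G, hG⟩ := ContinuousMap.exists_restrict_eq hK.isClosed ⟨K.domRestrict g, hg.domRestrict⟩
  have hGg : ∀ z ∈ K, G z = g z := fun z hz => congrFun (congrArg DFunLike.coe hG) ⟨z, hz⟩
  have hne : ∀ z, z ∉ U → z - p ≠ 0 := fun z hz h => hz (by rwa [sub_eq_zero.1 h])
  have hpf : ∀ z ∈ frontier U, z ∉ U := fun z hz h => by
    rw [hU.frontier_eq] at hz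
    exact hz.2 h
  -- The two formulas agree on the frontier of U because exp G = (z - p)^n · f there. So k is
  -- continuous and without zeros on the whole plane and has a global logarithm; on a circle around
  -- U this gives a logarithm of (z - p)^n.
  let k : ℂ → ℂ := U.piecewise (fun z => exp (-(G z)) * f z) (fun z => ((z - p) ^ n)⁻¹)
  have hk : Continuous k := by
    refine continuous_piecewise ?_ ?_ ?_
    · intro z hz
      have h1 := he z (hUK hz)
      have h2 := zpow_ne_zero n (hne z (hpf z hz))
      rw [exp_neg, hGg z (hUK hz), h1]
      have := hf0 z (frontier_subset_closure hz)
      field_simp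
    · exact (by fun_prop : Continuous fun z => exp (-(G z))).continuousOn.mul hf
    · refine ContinuousOn.inv₀ (ContinuousOn.zpow₀ (by fun_prop) _ ?_) ?_
      · intro z hz
        rw [hU.isClosed_compl.closure_eq] at hz
        exact Or.inl (hne z hz)
      · intro z hz
        rw [hU.isClosed_compl.closure_eq] at hz
        exact zpow_ne_zero n (hne z hz)
  have hk0 : ∀ z, k z ≠ 0 := by
    intro z
    by_cases hz : z ∈ U
    · simp [k, hz, hf0 z (subset_closure hz)]
    · simpa [k, hz] using zpow_ne_zero n (hne z hz)
  obtain ⟨F, hF, -, hFe⟩ := exists_continuous_log hk hk0 0 (exp_log (hk0 0))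
  obtain ⟨r, hr, hrU⟩ := hUb.subset_ball_lt 0 p
  refine eq_zero_of_hasLogOn_sphere hr (p := p) ⟨fun z => - F z, hF.neg.continuousOn, ?_⟩
  intro z hz
  have hzU : z ∉ U := fun h => by
    have h1 := hrU h
    rw [Metric.mem_ball] at h1
    rw [Metric.mem_sphere] at hz
    exact h1.ne hz
  rw [exp_neg, hFe]
  simp [k, hzU]

theorem frontier_connectedComponentIn_compl_subset {K : Set ℂ} (hK : IsClosed K) (p : ℂ) :
    frontier (connectedComponentIn Kᶜ p) ⊆ K := by
  intro z hz
  by_contra hzK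
  have ho : IsOpen (connectedComponentIn Kᶜ p) := hK.isOpen_compl.connectedComponentIn
  rw [ho.frontier_eq] at hz
  have hzo : IsOpen (connectedComponentIn Kᶜ z) := hK.isOpen_compl.connectedComponentIn
  obtain ⟨y, hy1, hy2⟩ := mem_closure_iff.1 hz.1 _ hzo (mem_connectedComponentIn hzK)
  apply hz.2
  rw [connectedComponentIn_eq hy2, ← connectedComponentIn_eq hy1]
  exact mem_connectedComponentIn hzK

theorem isPreconnected_compl_closedBall (r : ℝ) :
    IsPreconnected (Metric.closedBall (0 : ℂ) r)ᶜ := by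
  rcases lt_or_ge r 0 with hr | hr
  · rw [Metric.closedBall_eq_empty.2 hr, compl_empty]
    exact isPreconnected_univ
  have : (Metric.closedBall (0 : ℂ) r)ᶜ =
      (fun x : ℝ × ℝ => (x.1 : ℂ) * exp (x.2 * Complex.I)) '' (Ioi r ×ˢ univ) := by
    ext z
    simp only [mem_compl_iff, Metric.mem_closedBall, dist_zero_right, not_le, mem_image, mem_prod,
      mem_Ioi, mem_univ, and_true, Prod.exists]
    constructor
    · intro h
      exact ⟨‖z‖, arg z, h, norm_mul_exp_arg_mul_I z⟩
    · rintro ⟨a, b, h, rfl⟩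
      rw [norm_mul, norm_exp_ofReal_mul_I, mul_one, norm_real, Real.norm_eq_abs]
      exact lt_of_lt_of_le h (le_abs_self a)
  rw [this]
  refine IsPreconnected.image (isPreconnected_Ioi.prod isPreconnected_univ) _ ?_
  fun_prop

theorem exists_subset_closedBall {K : Set ℂ} (hK : IsCompact K) :
    ∃ r : ℝ, 0 < r ∧ K ⊆ Metric.closedBall 0 r :=
  let ⟨r, hr, h⟩ := hK.isBounded.subset_ball_lt 0 0
  ⟨r, hr, h.trans Metric.ball_subset_closedBall⟩

/-- The complement of a compact set has only one unbounded component. -/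
theorem eq_of_not_isBounded {K : Set ℂ} (hK : IsCompact K) {p q : ℂ}
    (hp : ¬ Bornology.IsBounded (connectedComponentIn Kᶜ p))
    (hq : ¬ Bornology.IsBounded (connectedComponentIn Kᶜ q)) :
    connectedComponentIn Kᶜ p = connectedComponentIn Kᶜ q := by
  obtain ⟨r, -, hr⟩ := exists_subset_closedBall hK
  have key : ∀ p, ¬ Bornology.IsBounded (connectedComponentIn Kᶜ p) →
      (Metric.closedBall (0 : ℂ) r)ᶜ ⊆ connectedComponentIn Kᶜ p := by
    intro p hp
    obtain ⟨x, hx, hxr⟩ : ∃ x ∈ connectedComponentIn Kᶜ p, x ∉ Metric.closedBall 0 r := by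
      by_contra! h
      exact hp (Metric.isBounded_closedBall.subset h)
    rw [connectedComponentIn_eq hx]
    exact (isPreconnected_compl_closedBall r).subset_connectedComponentIn hxr
      (compl_subset_compl.2 hr)
  have hz : (r.toNNReal + 1 : ℂ) ∈ (Metric.closedBall (0 : ℂ) r)ᶜ := by
    have h1 : ‖(r.toNNReal + 1 : ℂ)‖ = r.toNNReal + 1 := by
      rw [show (r.toNNReal + 1 : ℂ) = ((r.toNNReal + 1 : ℝ) : ℂ) by push_cast; rfl, norm_real,
        Real.norm_of_nonneg (by positivity)]
    simp only [mem_compl_iff, Metric.mem_closedBall, dist_zero_right, not_le, h1]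
    have := Real.le_coe_toNNReal r
    linarith
  rw [connectedComponentIn_eq (key p hp hz), connectedComponentIn_eq (key q hq hz)]

theorem exists_not_isBounded_connectedComponentIn {K : Set ℂ} (hK : IsCompact K) :
    ∃ p ∈ Kᶜ, ¬ Bornology.IsBounded (connectedComponentIn Kᶜ p) := by
  obtain ⟨r, hr0, hr⟩ := exists_subset_closedBall hK
  have h2 : ∀ R : ℝ, r < R → (R : ℂ) ∈ (Metric.closedBall (0 : ℂ) r)ᶜ := by
    intro R hR
    simp [abs_of_pos (hr0.trans hR), hR]
  have h1 := h2 (r + 1) (by linarith)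
  refine ⟨_, compl_subset_compl.2 hr h1, fun hb => ?_⟩
  have h3 := hb.subset ((isPreconnected_compl_closedBall r).subset_connectedComponentIn h1
      (compl_subset_compl.2 hr))
  obtain ⟨R, hR, hRb⟩ := h3.subset_ball_lt r 0
  have := hRb (h2 R hR)
  simp [abs_of_pos (hr0.trans hR)] at this

/-- **Eilenberg's criterion**, for products of three factors. -/
theorem eq_zero_of_hasLogOn_three {K : Set ℂ} (hK : IsCompact K) {p q r : ℂ} (hp : p ∉ K)
    (hb : Bornology.IsBounded (connectedComponentIn Kᶜ p))
    (hq : q ∉ K) (hr : r ∉ K)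
    (hpq : connectedComponentIn Kᶜ p ≠ connectedComponentIn Kᶜ q)
    (hpr : connectedComponentIn Kᶜ p ≠ connectedComponentIn Kᶜ r) {a b c : ℤ}
    (h : HasLogOn (fun z => (z - p) ^ a * ((z - q) ^ b * (z - r) ^ c)) K) : a = 0 := by
  have key : ∀ q ∉ K, connectedComponentIn Kᶜ p ≠ connectedComponentIn Kᶜ q →
      ∀ z ∈ closure (connectedComponentIn Kᶜ p), z - q ≠ 0 := by
    intro q hq hpq z hz h0
    rw [sub_eq_zero.1 h0] at hz
    rw [closure_eq_self_union_frontier] at hz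
    rcases hz with hz | hz
    · exact hpq (connectedComponentIn_eq hz)
    · exact hq (frontier_connectedComponentIn_compl_subset hK.isClosed _ hz)
  refine eq_zero_of_hasLogOn_zpow hK hK.isClosed.isOpen_compl.connectedComponentIn hb
    (frontier_connectedComponentIn_compl_subset hK.isClosed _) (mem_connectedComponentIn hp)
    (f := fun z => (z - q) ^ b * (z - r) ^ c) ?_ ?_ h
  · exact ContinuousOn.mul
      (ContinuousOn.zpow₀ (by fun_prop) _ fun z hz => Or.inl (key q hq hpq z hz))
      (ContinuousOn.zpow₀ (by fun_prop) _ fun z hz => Or.inl (key r hr hpr z hz))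
  · intro z hz
    exact mul_ne_zero (zpow_ne_zero _ (key q hq hpq z hz)) (zpow_ne_zero _ (key r hr hpr z hz))

/-- The converse of `hasLogOn_of_isPreconnected`. Of two distinct components at least one is
bounded, and for its point the exponent ±1 would have to vanish. The third factor is a dummy with
exponent 0. -/
theorem connectedComponentIn_eq_of_hasLogOn {K : Set ℂ} (hK : IsCompact K) {p q : ℂ} (hp : p ∉ K)
    (hq : q ∉ K) (h : HasLogOn (fun z => (z - p) / (z - q)) K) :
    connectedComponentIn Kᶜ p = connectedComponentIn Kᶜ q := by
  by_contra hne
  by_cases hb : Bornology.IsBounded (connectedComponentIn Kᶜ p)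
  · have := eq_zero_of_hasLogOn_three hK hp hb hq hq hne hne (a := 1) (b := -1) (c := 0)
      (h.congr fun z hz => by simp [div_eq_mul_inv])
    simp at this
  by_cases hb' : Bornology.IsBounded (connectedComponentIn Kᶜ q)
  · have := eq_zero_of_hasLogOn_three hK hq hb' hp hp (Ne.symm hne) (Ne.symm hne)
      (a := -1) (b := 1) (c := 0)
      (h.congr fun z hz => by simp [div_eq_inv_mul])
    simp at this
  exact hne (eq_of_not_isBounded hK hb hb')

/-- If the differences of three points satisfy a relation, then the points do not lie in three
distinct components. -/
theorem not_three_components {K : Set ℂ} (hK : IsCompact K) {p q r : ℂ} (hp : p ∉ K)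
    (hq : q ∉ K) (hr : r ∉ K)
    (hpq : connectedComponentIn Kᶜ p ≠ connectedComponentIn Kᶜ q)
    (hpr : connectedComponentIn Kᶜ p ≠ connectedComponentIn Kᶜ r)
    (hqr : connectedComponentIn Kᶜ q ≠ connectedComponentIn Kᶜ r) {a b : ℤ}
    (h : HasLogOn (fun z => ((z - p) / (z - q)) ^ b * (((z - p) / (z - r)) ^ a)⁻¹) K) :
    a = 0 ∧ b = 0 := by
  have hne : ∀ q ∉ K, ∀ z ∈ K, z - q ≠ 0 := fun q hq z hz h0 => hq (by rwa [← sub_eq_zero.1 h0])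
  have h' : HasLogOn (fun z => (z - p) ^ (b - a) * ((z - q) ^ (-b) * (z - r) ^ a)) K := by
    refine h.congr fun z hz => ?_
    have h1 := hne p hp z hz
    have h2 := hne q hq z hz
    have h3 := hne r hr z hz
    rw [div_zpow, div_zpow, zpow_sub₀ h1, zpow_neg]
    have := zpow_ne_zero a h1
    have := zpow_ne_zero a h3
    have := zpow_ne_zero b h2
    field_simp
  have e1 : Bornology.IsBounded (connectedComponentIn Kᶜ p) → b - a = 0 := fun hb =>
    eq_zero_of_hasLogOn_three hK hp hb hq hr hpq hpr h'
  have e2 : Bornology.IsBounded (connectedComponentIn Kᶜ q) → -b = 0 := fun hb =>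
    eq_zero_of_hasLogOn_three hK hq hb hp hr hpq.symm hqr
      (h'.congr fun z hz => by ring : HasLogOn
        (fun z => (z - q) ^ (-b) * ((z - p) ^ (b - a) * (z - r) ^ a)) K)
  have e3 : Bornology.IsBounded (connectedComponentIn Kᶜ r) → a = 0 := fun hb =>
    eq_zero_of_hasLogOn_three hK hr hb hp hq hpr.symm hqr.symm
      (h'.congr fun z hz => by ring : HasLogOn
        (fun z => (z - r) ^ a * ((z - p) ^ (b - a) * (z - q) ^ (-b))) K)
  -- At most one of the three components is unbounded, and the vanishing of any two of the exponents
  -- b - a, -b, a forces a = b = 0.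
  by_cases hbp : Bornology.IsBounded (connectedComponentIn Kᶜ p)
  · by_cases hbq : Bornology.IsBounded (connectedComponentIn Kᶜ q)
    · have := e1 hbp; have := e2 hbq; omega
    · by_cases hbr : Bornology.IsBounded (connectedComponentIn Kᶜ r)
      · have := e1 hbp; have := e3 hbr; omega
      · exact absurd (eq_of_not_isBounded hK hbq hbr) hqr
  · by_cases hbq : Bornology.IsBounded (connectedComponentIn Kᶜ q)
    · by_cases hbr : Bornology.IsBounded (connectedComponentIn Kᶜ r)
      · have := e2 hbq; have := e3 hbr; omega
      · exact absurd (eq_of_not_isBounded hK hbp hbr) hpr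
    · exact absurd (eq_of_not_isBounded hK hbp hbq) hpq

end PlaneTopology

end

/-! ### Separation of the plane by a simple closed curve -/

noncomputable section

namespace PlaneTopology

open Set Filter Topology Complex

/-- The difference of the two logarithms, normalized at a, is continuous with values in 2πiℤ, hence
zero on the connected set. -/
theorem sub_eq_sub_of_exp_eq {K : Set ℂ} (hK : IsPreconnected K) {g h : ℂ → ℂ}
    (hg : ContinuousOn g K) (hh : ContinuousOn h K) {c : ℂ}
    (he : ∀ z ∈ K, exp (g z) = c * exp (h z)) {a b : ℂ} (ha : a ∈ K) (hb : b ∈ K) :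
    g b - g a = h b - h a := by
  have hpi : (2 * Real.pi * Complex.I : ℂ) ≠ 0 := two_pi_I_ne_zero
  let F : ℂ → ℂ := fun z => (g z - h z - (g a - h a)) / (2 * Real.pi * Complex.I)
  have hF : ContinuousOn F K := ((hg.sub hh).sub continuousOn_const).div_const _
  have hint : ∀ z ∈ K, ∃ k : ℤ, F z = k := by
    intro z hz
    have h0 : c ≠ 0 := fun h => exp_ne_zero (g a) (by rw [he a ha, h, zero_mul])
    have h1 : exp (g z - h z - (g a - h a)) = 1 := by
      rw [exp_sub, exp_sub, exp_sub, he z hz, he a ha]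
      have := exp_ne_zero (h z)
      have := exp_ne_zero (h a)
      field_simp
    obtain ⟨k, hk⟩ := exp_eq_one_iff.1 h1
    refine ⟨k, ?_⟩
    simp only [F, hk]
    field_simp
  let k : ℂ → ℤ := fun z => round (F z).re
  have hk : ∀ z ∈ K, F z = k z := by
    intro z hz
    obtain ⟨m, hm⟩ := hint z hz
    simp [k, hm]
  have hkc : ContinuousOn k K := by
    rw [Int.isClosedEmbedding_coe_real.isInducing.continuousOn_iff]
    refine (continuous_re.comp_continuousOn hF).congr fun z hz => ?_
    simp [hk z hz]
  have hconst : k a = k b := hK.constant hkc ha hb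
  have h0 : F a = 0 := by simp [F]
  have h1 : F b = 0 := by rw [hk b hb, ← hconst, ← hk a ha, h0]
  have h2 := (div_eq_zero_iff.1 h1).resolve_right hpi
  linear_combination h2

theorem isPreconnected_reProdIm {s t : Set ℝ} (hs : Convex ℝ s) (ht : Convex ℝ t) :
    IsPreconnected (s ×ℂ t) := by
  have : s ×ℂ t = (fun x : ℝ × ℝ => (x.1 + x.2 * Complex.I : ℂ)) '' (s ×ˢ t) := by
    ext z
    simp only [mem_reProdIm, mem_image, mem_prod, Prod.exists]
    constructor
    · rintro ⟨h1, h2⟩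
      exact ⟨z.re, z.im, ⟨h1, h2⟩, re_add_im z⟩
    · rintro ⟨a, b, h, rfl⟩
      simpa using h
  rw [this]
  exact (hs.isPreconnected.prod ht.isPreconnected).image _ (by fun_prop)

/-- The three lower sides of a box. -/
def lowerBox : Set ℂ := {-1} ×ℂ Icc (-4) 0 ∪ Icc (-1) 1 ×ℂ {-4} ∪ {1} ×ℂ Icc (-4) 0

theorem isCompact_lowerBox : IsCompact lowerBox :=
  ((isCompact_singleton.reProdIm isCompact_Icc).union
    (isCompact_Icc.reProdIm isCompact_singleton)).union
    (isCompact_singleton.reProdIm isCompact_Icc)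

theorem isPreconnected_lowerBox : IsPreconnected lowerBox := by
  refine IsPreconnected.union (1 - 4 * Complex.I) ?_ ?_
    (IsPreconnected.union (-1 - 4 * Complex.I) ?_ ?_
      (isPreconnected_reProdIm (convex_singleton _) (convex_Icc _ _))
      (isPreconnected_reProdIm (convex_Icc _ _) (convex_singleton _)))
      (isPreconnected_reProdIm (convex_singleton _) (convex_Icc _ _)) <;>
  simp [mem_reProdIm]

theorem mem_lowerBox {z : ℂ} (hz : z ∈ lowerBox) :
    (z.re = -1 ∧ z.im ≤ 0 ∨ z.re = 1 ∧ z.im ≤ 0 ∨ z.im = -4) := by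
  simp only [lowerBox, mem_union, mem_reProdIm, mem_singleton_iff, mem_Icc] at hz
  tauto

theorem re_sub_div_add (z : ℂ) : ((z - 3 * Complex.I) / (z + 3 * Complex.I)).re =
    (z.re ^ 2 + z.im ^ 2 - 9) / normSq (z + 3 * Complex.I) := by
  simp [div_re]; ring

theorem im_sub_div_add (z : ℂ) : ((z - 3 * Complex.I) / (z + 3 * Complex.I)).im =
    -6 * z.re / normSq (z + 3 * Complex.I) := by
  simp [div_im]; ring

/-- Let A carry the top point of the imaginary axis, let m·i be the lowest point of A on the axis,
and w·i a point just below it. Then 3i reaches w·i off B and the lower box by going down the axis,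
along A' and down again (`N`), while w·i reaches -3i off A and the box (`S`). If also 3i and w·i
were joined off A ∪ B, the three resulting logarithms would show that log f, with f = (z - 3i)/(z +
3i), changes by the same amount from -1 to 1 along A as along the box. But A passes above -3i and
the box below it. -/
theorem not_isPreconnected_compl_of_top {A A' B : Set ℂ}
    (hA : IsCompact A) (hB : IsCompact B) (hAc : IsPreconnected A) (hBc : IsPreconnected B)
    (hA' : IsPreconnected A') (hAA' : A = A' ∪ {-1, 1}) (hd : Disjoint A' B)
    (hB1 : -1 ∈ B ∧ 1 ∈ B) (hJ : ∀ z ∈ A ∪ B, ‖z - 1‖ ≤ 2 ∧ ‖z + 1‖ ≤ 2)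
    {y₀ : ℝ} (hy₀ : (y₀ * Complex.I) ∈ A) (htop : ∀ y > y₀, (y * Complex.I) ∉ B) :
    ¬ IsPreconnected (A ∪ B)ᶜ := by
  intro hpre
  have hbound : ∀ z ∈ A ∪ B, (z.re - 1) ^ 2 + z.im ^ 2 ≤ 4 ∧ (z.re + 1) ^ 2 + z.im ^ 2 ≤ 4 := by
    intro z hz
    obtain ⟨h1, h2⟩ := hJ z hz
    have e1 : ‖z - 1‖ ^ 2 = (z.re - 1) ^ 2 + z.im ^ 2 := by
      rw [← normSq_eq_norm_sq, normSq_apply]; simp; ring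
    have e2 : ‖z + 1‖ ^ 2 = (z.re + 1) ^ 2 + z.im ^ 2 := by
      rw [← normSq_eq_norm_sq, normSq_apply]; simp; ring
    constructor
    · rw [← e1]; nlinarith [norm_nonneg (z - 1)]
    · rw [← e2]; nlinarith [norm_nonneg (z + 1)]
  have hA1 : -1 ∈ A ∧ 1 ∈ A := by rw [hAA']; simp
  have haxis : ∀ y : ℝ, (y * Complex.I) ∈ A → (y * Complex.I) ∈ A' := by
    intro y hy
    rw [hAA'] at hy
    rcases hy with hy | hy | hy
    · exact hy
    · have := congrArg re hy; simp at this
    · have := congrArg re (mem_singleton_iff.1 hy); simp at this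
  have hbd : ∀ y : ℝ, (y * Complex.I) ∈ A ∪ B → y ^ 2 ≤ 3 := by
    intro y hy
    have := (hbound _ hy).1
    simp at this
    linarith
  -- the lowest point of `A` on the axis
  have hcont : Continuous fun y : ℝ => (y * Complex.I : ℂ) := by fun_prop
  have hYc : IsCompact {y : ℝ | (y * Complex.I) ∈ A} := by
    refine Metric.isCompact_of_isClosed_isBounded (hA.isClosed.preimage hcont) ?_
    refine (Metric.isBounded_Icc (-2 : ℝ) 2).subset fun y hy => ?_
    have := hbd y (Or.inl hy)
    constructor <;> nlinarith
  obtain ⟨m, hm, hmin⟩ := hYc.exists_isLeast ⟨y₀, hy₀⟩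
  have hmin : ∀ y : ℝ, (y * Complex.I) ∈ A → m ≤ y := fun y hy => hmin hy
  have hmB : (m * Complex.I : ℂ) ∉ B := disjoint_left.1 hd (haxis m hm)
  have hm2 := hbd m (Or.inl hm)
  have hy2 := hbd y₀ (Or.inl hy₀)
  obtain ⟨ε, hε, hεB⟩ := Metric.isOpen_iff.1 (hB.isClosed.isOpen_compl.preimage hcont) m hmB
  -- A step of length at most 1 keeps w above -3, because m² ≤ 3.
  obtain ⟨w, hw1, hw2, hw3⟩ : ∃ w < m, -3 < w ∧ ∀ y ∈ Icc w m, (y * Complex.I : ℂ) ∉ B := by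
    refine ⟨m - min (ε / 2) 1, by have := lt_min (half_pos hε) one_pos; linarith, ?_, ?_⟩
    · have := min_le_right (ε / 2) 1; nlinarith
    · intro y hy
      refine @hεB y ?_
      rw [Metric.mem_ball, Real.dist_eq, abs_lt]
      have := min_le_left (ε / 2) 1
      have := lt_min (half_pos hε) one_pos
      constructor <;> linarith [hy.1, hy.2]
  have hz : ∀ z : ℂ, z.re = 0 → z = z.im * Complex.I := fun z hz => by
    apply Complex.ext <;> simp [hz]
  have hmy := hmin y₀ hy₀
  -- connected sets
  let N : Set ℂ := {0} ×ℂ Icc y₀ 3 ∪ A' ∪ {0} ×ℂ Icc w m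
  have hN : IsPreconnected N := by
    refine IsPreconnected.union (m * Complex.I) (Or.inr (haxis m hm)) ?_ (IsPreconnected.union
      (y₀ * Complex.I) ?_ (haxis _ hy₀)
      (isPreconnected_reProdIm (convex_singleton _) (convex_Icc _ _)) hA')
      (isPreconnected_reProdIm (convex_singleton _) (convex_Icc _ _))
    · simp [mem_reProdIm, hw1.le]
    · simp only [mem_reProdIm, mul_re, ofReal_re, I_re, mul_zero, ofReal_im, I_im, mul_one,
        sub_self, mem_singleton_iff, mul_im, mem_Icc, true_and, le_refl, add_zero]
      nlinarith
  have hnN : 3 * Complex.I ∈ N := by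
    refine Or.inl (Or.inl ?_)
    simp [mem_reProdIm]; nlinarith
  have hwN : w * Complex.I ∈ N := by
    refine Or.inr ?_
    simp [mem_reProdIm, hw1.le]
  have hNd : Disjoint N (B ∪ lowerBox) := by
    rw [disjoint_left]
    rintro z ((hzN | hzN) | hzN) (hzB | hzL)
    · rw [hz z hzN.1] at hzB
      rcases hzN.2.1.lt_or_eq with h | h
      · exact htop _ h hzB
      · rw [← h] at hzB
        exact disjoint_left.1 hd (haxis _ hy₀) hzB
    · have h1 : z.re = 0 := hzN.1
      have h2 : y₀ ≤ z.im := hzN.2.1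
      rcases mem_lowerBox hzL with h | h | h
      · linarith [h.1]
      · linarith [h.1]
      · nlinarith
    · exact disjoint_left.1 hd hzN hzB
    · have hzA : z ∈ A := by rw [hAA']; exact Or.inl hzN
      -- The lens given by the two bounds meets the box only in -1 and 1, which belong to B and so
      -- not to A'.
      obtain ⟨b1, b2⟩ := hbound z (Or.inl hzA)
      rcases mem_lowerBox hzL with h | h | h
      · have him : z.im = 0 := by rw [h.1] at b1; nlinarith
        have : z = -1 := by apply Complex.ext <;> simp [h.1, him]
        exact disjoint_left.1 hd hzN (this ▸ hB1.1)
      · have him : z.im = 0 := by rw [h.1] at b2; nlinarith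
        have : z = 1 := by apply Complex.ext <;> simp [h.1, him]
        exact disjoint_left.1 hd hzN (this ▸ hB1.2)
      · rw [h] at b1; nlinarith
    · rw [hz z hzN.1] at hzB
      exact hw3 _ hzN.2 hzB
    · have h1 : z.re = 0 := hzN.1
      have h2 : w ≤ z.im := hzN.2.1
      rcases mem_lowerBox hzL with ⟨h, -⟩ | ⟨h, -⟩ | h <;> linarith
  let S : Set ℂ := {0} ×ℂ Icc (-3) w
  have hS : IsPreconnected S := isPreconnected_reProdIm (convex_singleton _) (convex_Icc _ _)
  have hsS : -3 * Complex.I ∈ S := by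
    simp [S, mem_reProdIm, hw2.le]
  have hwS : w * Complex.I ∈ S := by
    simp [S, mem_reProdIm, hw2.le]
  have hSd : Disjoint S (A ∪ lowerBox) := by
    rw [disjoint_left]
    rintro z hzS (hzA | hzL)
    · rw [hz z hzS.1] at hzA
      linarith [hmin _ hzA, hzS.2.2]
    · have h1 : z.re = 0 := hzS.1
      have h2 : -3 ≤ z.im := hzS.2.1
      rcases mem_lowerBox hzL with ⟨h, -⟩ | ⟨h, -⟩ | h <;> linarith
  have hn : 3 * Complex.I ∈ (A ∪ B)ᶜ := fun h => by
    have := hbd 3 (by exact_mod_cast h)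
    norm_num at this
  have hwJ : w * Complex.I ∈ (A ∪ B)ᶜ := by
    rintro (h | h)
    · linarith [hmin _ h]
    · exact hw3 w ⟨le_rfl, hw1.le⟩ h
  -- logarithms
  obtain ⟨g₁, c₁, e₁⟩ := hasLogOn_of_isPreconnected (hB.union isCompact_lowerBox) hN hNd hnN hwN
  obtain ⟨g₂, c₂, e₂⟩ := hasLogOn_of_isPreconnected (hA.union isCompact_lowerBox) hS hSd hsS hwS
  obtain ⟨g₃, c₃, e₃⟩ := hasLogOn_of_isPreconnected (hA.union hB) hpre disjoint_compl_left hn hwJ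
  have hL1 : (-1 : ℂ) ∈ lowerBox ∧ (1 : ℂ) ∈ lowerBox := by
    constructor <;> simp [lowerBox, mem_reProdIm]
  have d₁ := sub_eq_sub_of_exp_eq hBc (c₁.mono subset_union_left) (c₃.mono subset_union_right)
    (c := 1) (fun z hz => by rw [e₁ z (Or.inl hz), e₃ z (Or.inr hz), one_mul]) hB1.1 hB1.2
  let f : ℂ → ℂ := fun z => (z - 3 * Complex.I) / (z + 3 * Complex.I)
  have hquot : ∀ z w : ℂ, z ≠ w → (z - 3 * Complex.I) / (z - w) / ((z - -3 * Complex.I) / (z - w)) =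
      f z := by
    intro z w h
    have := sub_ne_zero.2 h
    simp only [f]
    rw [div_div_div_cancel_right₀ this]
    ring_nf
  have hnorm : ∀ z : ℂ, z + 3 * Complex.I ≠ 0 → 0 < normSq (z + 3 * Complex.I) :=
    fun z h => normSq_pos.2 h
  have hAs : ∀ z ∈ A, z + 3 * Complex.I ≠ 0 := by
    intro z hzA h
    have : z = (-3 : ℝ) * Complex.I := by rw [eq_neg_of_add_eq_zero_left h]; push_cast; ring
    have := hbd (-3) (Or.inl (this ▸ hzA))
    norm_num at this
  have hLs : ∀ z ∈ lowerBox, z + 3 * Complex.I ≠ 0 := by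
    intro z hzL h
    have : z = (-3 : ℝ) * Complex.I := by rw [eq_neg_of_add_eq_zero_left h]; push_cast; ring
    rcases mem_lowerBox hzL with h | h | h <;> rw [this] at h <;> norm_num at h
  have hfA : ∀ z ∈ A, -f z ∈ slitPlane := by
    intro z hzA
    left
    obtain ⟨b1, b2⟩ := hbound z (Or.inl hzA)
    have h1 := hnorm z (hAs z hzA)
    simp only [f]
    rw [neg_re, re_sub_div_add, ← neg_div]
    apply div_pos _ h1
    nlinarith
  have hfL : ∀ z ∈ lowerBox, f z ∈ slitPlane := by
    intro z hzL
    have h1 := hnorm z (hLs z hzL)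
    simp only [f]
    rcases mem_lowerBox hzL with h | h | h
    · right
      rw [im_sub_div_add, h.1]
      exact div_ne_zero (by norm_num) h1.ne'
    · right
      rw [im_sub_div_add, h.1]
      exact div_ne_zero (by norm_num) h1.ne'
    · left
      rw [re_sub_div_add]
      apply div_pos _ h1
      rw [h]; nlinarith
  have c₄ : ContinuousOn (fun z => log (-f z)) A :=
    ContinuousOn.clog (ContinuousOn.neg (ContinuousOn.div (by fun_prop) (by fun_prop) hAs)) hfA
  have c₅ : ContinuousOn (fun z => log (f z)) lowerBox :=
    ContinuousOn.clog (ContinuousOn.div (by fun_prop) (by fun_prop) hLs) hfL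
  have hwA : ∀ z ∈ A ∪ lowerBox, z ≠ w * Complex.I := fun z hz h =>
    disjoint_left.1 hSd hwS (h ▸ hz)
  have d₂ := sub_eq_sub_of_exp_eq (g := fun z => g₃ z - g₂ z) hAc
    ((c₃.mono subset_union_left).sub (c₂.mono subset_union_left)) c₄
    (c := -1) (fun z hz => by
      rw [exp_sub, e₃ z (Or.inl hz), e₂ z (Or.inl hz), exp_log (slitPlane_ne_zero (hfA z hz)),
        hquot z _ (hwA z (Or.inl hz))]
      ring) hA1.1 hA1.2
  have d₃ := sub_eq_sub_of_exp_eq (g := fun z => g₁ z - g₂ z) isPreconnected_lowerBox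
    ((c₁.mono subset_union_right).sub (c₂.mono subset_union_right)) c₅
    (c := 1) (fun z hz => by
      rw [exp_sub, e₁ z (Or.inr hz), e₂ z (Or.inr hz), exp_log (slitPlane_ne_zero (hfL z hz)),
        hquot z _ (hwA z (Or.inr hz))]
      ring) hL1.1 hL1.2
  -- Along A the values of f avoid the positive real axis, along the box the negative one. Hence log
  -- (-f) and log f measure the two changes, and their imaginary parts turn out to have opposite
  -- signs.
  have d : log (-f 1) - log (-f (-1)) = log (f 1) - log (f (-1)) := by
    rw [← d₂, ← d₃]
    linear_combination -d₁
  have him := congrArg im d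
  simp only [sub_im, log_im] at him
  have i₁ : (f 1).im < 0 := by simp [f, div_im, normSq_apply]; norm_num
  have i₂ : 0 < (f (-1)).im := by simp [f, div_im, normSq_apply]; norm_num
  have a₁ := arg_neg_iff.2 i₁
  have a₂ := arg_nonneg_iff.2 i₂.le
  have a₃ : 0 ≤ arg (-f 1) := arg_nonneg_iff.2 (by rw [neg_im]; linarith)
  have a₄ : arg (-f (-1)) < 0 := arg_neg_iff.2 (by rw [neg_im]; linarith)
  linarith

/-- The highest point of A ∪ B on the imaginary axis lies on A or on B, and the hypotheses are
symmetric in the two. The axis is met because A is connected and joins -1 to 1. -/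
theorem not_isPreconnected_compl_of_arcs {A A' B B' : Set ℂ}
    (hA : IsCompact A) (hB : IsCompact B) (hAc : IsPreconnected A) (hBc : IsPreconnected B)
    (hA' : IsPreconnected A') (hAA' : A = A' ∪ {-1, 1})
    (hB' : IsPreconnected B') (hBB' : B = B' ∪ {-1, 1}) (hd : Disjoint A' B) (hd' : Disjoint B' A)
    (hJ : ∀ z ∈ A ∪ B, ‖z - 1‖ ≤ 2 ∧ ‖z + 1‖ ≤ 2) :
    ¬ IsPreconnected (A ∪ B)ᶜ := by
  have hA1 : -1 ∈ A ∧ 1 ∈ A := by rw [hAA']; simp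
  have hB1 : -1 ∈ B ∧ 1 ∈ B := by rw [hBB']; simp
  have hcont : Continuous fun y : ℝ => (y * Complex.I : ℂ) := by fun_prop
  obtain ⟨x, hxA, hx⟩ : ∃ x ∈ A, x.re = 0 := by
    have := hAc.intermediate_value hA1.1 hA1.2 continuous_re.continuousOn
    obtain ⟨x, hx, h⟩ := @this 0 (by simp)
    exact ⟨x, hx, h⟩
  have hx' : x = x.im * Complex.I := by apply Complex.ext <;> simp [hx]
  have hYc : IsCompact {y : ℝ | (y * Complex.I) ∈ A ∪ B} := by
    refine Metric.isCompact_of_isClosed_isBounded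
      ((hA.union hB).isClosed.preimage hcont) ?_
    obtain ⟨r, hr⟩ := (hA.union hB).isBounded.subset_closedBall 0
    refine (Metric.isBounded_closedBall (x := (0 : ℝ)) (r := r)).subset fun y hy => ?_
    have := hr hy
    simpa using this
  obtain ⟨y₀, hy₀, hmax⟩ := hYc.exists_isGreatest
    ⟨x.im, by rw [mem_ofPred_eq, ← hx']; exact Or.inl hxA⟩
  have hmax : ∀ y > y₀, (y * Complex.I : ℂ) ∉ A ∪ B := fun y hy h => not_le.2 hy (hmax h)
  rcases hy₀ with h | h
  · exact not_isPreconnected_compl_of_top hA hB hAc hBc hA' hAA' hd hB1 hJ h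
      fun y hy hy' => hmax y hy (Or.inr hy')
  · rw [union_comm] at hJ ⊢
    exact not_isPreconnected_compl_of_top hB hA hBc hAc hB' hBB' hd' hA1 hJ h
      fun y hy hy' => hmax y hy (Or.inl hy')

/-- A simple closed curve separates the plane. -/
theorem not_isPreconnected_compl_simpleClosedCurve {L : ℝ} (hL : 0 < L) {c : ℝ → ℂ}
    (hc : ContinuousOn c (Icc 0 L)) (hinj : InjOn c (Ico 0 L)) (hcl : c 0 = c L) :
    ¬ IsPreconnected (c '' Icc 0 L)ᶜ := by
  have hJc : IsCompact (c '' Icc 0 L) := isCompact_Icc.image_of_continuousOn hc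
  have himg : c '' Icc 0 L = c '' Ico 0 L := by
    refine Subset.antisymm ?_ (image_mono Ico_subset_Icc_self)
    rintro _ ⟨t, ht, rfl⟩
    rcases ht.2.lt_or_eq with h | h
    · exact ⟨t, ⟨ht.1, h⟩, rfl⟩
    · exact ⟨0, ⟨le_rfl, hL⟩, by rw [hcl, h]⟩
  have hne : (c '' Icc 0 L).Nonempty := ⟨c 0, 0, ⟨le_rfl, hL.le⟩, rfl⟩
  -- Two points of the curve at maximal distance: the affine map `φ` below takes them to -1 and 1,
  -- and maximality puts the image into the lens ‖z - 1‖ ≤ 2, ‖z + 1‖ ≤ 2.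
  obtain ⟨⟨a, b⟩, ⟨ha, hb⟩, hmax⟩ := (hJc.prod hJc).exists_isMaxOn (hne.prod hne)
    (f := fun x : ℂ × ℂ => dist x.1 x.2) (by fun_prop)
  have hmax : ∀ x ∈ c '' Icc 0 L, ∀ y ∈ c '' Icc 0 L, dist x y ≤ dist a b :=
    fun x hx y hy => hmax (mk_mem_prod hx hy)
  have hpos : 0 < dist a b := by
    refine lt_of_lt_of_le ?_ (hmax (c 0) ⟨0, ⟨le_rfl, hL.le⟩, rfl⟩ (c (L / 2))
      ⟨L / 2, ⟨by linarith, by linarith⟩, rfl⟩)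
    rw [dist_pos]
    intro h
    have := hinj ⟨le_rfl, hL⟩ ⟨by linarith, by linarith⟩ h
    linarith
  rw [himg] at ha hb
  obtain ⟨s, t, hs, hst, ht, hmax, hpos⟩ : ∃ s t, 0 ≤ s ∧ s < t ∧ t < L ∧
      (∀ x ∈ c '' Icc 0 L, ∀ y ∈ c '' Icc 0 L, dist x y ≤ dist (c s) (c t)) ∧
      0 < dist (c s) (c t) := by
    obtain ⟨s, hs, rfl⟩ := ha
    obtain ⟨t, ht, rfl⟩ := hb
    rcases lt_trichotomy s t with h | h | h
    · exact ⟨s, t, hs.1, h, ht.2, hmax, hpos⟩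
    · rw [h, dist_self] at hpos; exact absurd hpos (lt_irrefl _)
    · rw [dist_comm] at hpos hmax
      exact ⟨t, s, ht.1, h, hs.2, hmax, hpos⟩
  have hab : c t - c s ≠ 0 := by
    intro h
    rw [dist_comm, dist_eq_norm, h, norm_zero] at hpos
    exact lt_irrefl _ hpos
  let φ : ℂ → ℂ := fun z => (2 * z - c s - c t) / (c t - c s)
  have hφ : Continuous φ := by fun_prop
  have hφi : Function.Injective φ := by
    intro x y h
    simp only [φ] at h
    rw [div_left_inj' hab] at h
    linear_combination h / 2
  have hφs : Function.Surjective φ := by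
    intro y
    refine ⟨(y * (c t - c s) + c s + c t) / 2, ?_⟩
    simp only [φ]
    field_simp
    ring
  have h1 : φ (c s) = -1 := by simp only [φ]; field_simp; ring
  have h2 : φ (c t) = 1 := by simp only [φ]; field_simp; ring
  have hk : ContinuousOn (φ ∘ c) (Icc 0 L) := hφ.comp_continuousOn hc
  have hki : InjOn (φ ∘ c) (Ico 0 L) := hφi.comp_injOn hinj
  have hkcl : (φ ∘ c) 0 = (φ ∘ c) L := by simp [hcl]
  have h1' : (φ ∘ c) s = -1 := h1
  have h2' : (φ ∘ c) t = 1 := h2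
  have hsub : ∀ u v, 0 ≤ u → v ≤ L → ContinuousOn (φ ∘ c) (Icc u v) :=
    fun u v hu hv => hk.mono (Icc_subset_Icc hu hv)
  intro hpre
  have hpre' : IsPreconnected (φ '' (c '' Icc 0 L)ᶜ) := hpre.image _ hφ.continuousOn
  rw [image_compl_eq ⟨hφi, hφs⟩, ← image_comp] at hpre'
  have hJ : (φ ∘ c) '' Icc 0 L =
      (φ ∘ c) '' Icc s t ∪ ((φ ∘ c) '' Icc 0 s ∪ (φ ∘ c) '' Icc t L) := by
    rw [← image_union, ← image_union, union_comm (Icc 0 s), ← union_assoc,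
      Icc_union_Icc_eq_Icc hst.le ht.le, union_comm, Icc_union_Icc_eq_Icc hs (hst.le.trans ht.le)]
  rw [hJ] at hpre'
  -- The second arc runs through the base point c 0 = c L. If s = 0, the base point is itself an end
  -- of the arc and must be left out of B'.
  obtain ⟨B', hB', hBB', hd⟩ : ∃ B', IsPreconnected B' ∧
      (φ ∘ c) '' Icc 0 s ∪ (φ ∘ c) '' Icc t L = B' ∪ {-1, 1} ∧
      Disjoint B' ((φ ∘ c) '' Icc s t) := by
    rcases hs.eq_or_lt with rfl | h
    · refine ⟨(φ ∘ c) '' Ioo t L, isPreconnected_Ioo.image _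
        ((hsub _ _ hst.le le_rfl).mono Ioo_subset_Icc_self), ?_, ?_⟩
      · have h1L : (φ ∘ c) L = -1 := hkcl ▸ h1'
        rw [Icc_self, image_singleton, ← Ioo_union_both ht.le, image_union, image_pair, h1', h2',
          h1L]
        ext z
        simp only [mem_union, mem_insert_iff, mem_singleton_iff]
        tauto
      · rw [disjoint_left]
        rintro _ ⟨x, hx, rfl⟩ ⟨y, hy, h⟩
        have := hki ⟨by linarith [hy.1], by linarith [hy.2]⟩ ⟨by linarith [hx.1], hx.2⟩ h
        linarith [hx.1, hy.2]
    · refine ⟨(φ ∘ c) '' Ico 0 s ∪ (φ ∘ c) '' Ioc t L,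
        IsPreconnected.union ((φ ∘ c) 0) ⟨0, ⟨le_rfl, h⟩, rfl⟩ ⟨L, ⟨ht, le_rfl⟩, hkcl.symm⟩
        (isPreconnected_Ico.image _
          ((hsub _ _ le_rfl (hst.le.trans ht.le)).mono Ico_subset_Icc_self))
        (isPreconnected_Ioc.image _ ((hsub _ _ (hs.trans hst.le) le_rfl).mono
          Ioc_subset_Icc_self)), ?_, ?_⟩
      · rw [← h1', ← h2', ← Ico_union_right hs, ← Ioc_union_left ht.le, image_union, image_union,
          image_singleton, image_singleton]
        ext z
        simp only [mem_union, mem_insert_iff, mem_singleton_iff]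
        tauto
      · rw [disjoint_left]
        rintro _ (⟨x, hx, rfl⟩ | ⟨x, hx, rfl⟩) ⟨y, hy, h⟩
        · have := hki ⟨by linarith [hy.1], by linarith [hy.2]⟩ ⟨hx.1, by linarith [hx.2]⟩ h
          linarith [hy.1, hx.2]
        · rcases hx.2.lt_or_eq with h' | h'
          · have := hki ⟨by linarith [hy.1], by linarith [hy.2]⟩ ⟨by linarith [hx.1], h'⟩ h
            linarith [hy.2, hx.1]
          · rw [h', ← hkcl] at h
            have := hki ⟨by linarith [hy.1], by linarith [hy.2]⟩ ⟨le_rfl, hL⟩ h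
            linarith [hy.1]
  refine not_isPreconnected_compl_of_arcs (A' := (φ ∘ c) '' Ioo s t) ?_ ?_ ?_ ?_ ?_ ?_ hB' hBB' ?_
    hd ?_ hpre'
  · exact isCompact_Icc.image_of_continuousOn (hsub _ _ hs ht.le)
  · exact (isCompact_Icc.image_of_continuousOn (hsub _ _ le_rfl (hst.le.trans ht.le))).union
      (isCompact_Icc.image_of_continuousOn (hsub _ _ (hs.trans hst.le) le_rfl))
  · exact isPreconnected_Icc.image _ (hsub _ _ hs ht.le)
  · refine IsPreconnected.union ((φ ∘ c) 0) ⟨0, ⟨le_rfl, hs⟩, rfl⟩ ⟨L, ⟨ht.le, le_rfl⟩, hkcl.symm⟩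
      (isPreconnected_Icc.image _ (hsub _ _ le_rfl (hst.le.trans ht.le)))
      (isPreconnected_Icc.image _ (hsub _ _ (hs.trans hst.le) le_rfl))
  · exact isPreconnected_Ioo.image _ ((hsub _ _ hs ht.le).mono Ioo_subset_Icc_self)
  · rw [← h1', ← h2', ← image_pair, ← image_union, Ioo_union_both hst.le]
  · rw [disjoint_left]
    rintro _ ⟨x, hx, rfl⟩ (⟨y, hy, h⟩ | ⟨y, hy, h⟩)
    · have := hki ⟨hy.1, by linarith [hy.2]⟩ ⟨by linarith [hx.1], by linarith [hx.2]⟩ h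
      linarith [hy.2, hx.1]
    · rcases hy.2.lt_or_eq with h' | h'
      · have := hki ⟨by linarith [hy.1], h'⟩ ⟨by linarith [hx.1], by linarith [hx.2]⟩ h
        linarith [hy.1, hx.2]
      · rw [h', ← hkcl] at h
        have := hki ⟨le_rfl, hL⟩ ⟨by linarith [hx.1], by linarith [hx.2]⟩ h
        linarith [hx.1]
  · rw [← hJ, image_comp]
    rintro _ ⟨z, hz, rfl⟩
    have e1 : φ z - 1 = 2 * ((z - c t) / (c t - c s)) := by simp only [φ]; field_simp; ring
    have e2 : φ z + 1 = 2 * ((z - c s) / (c t - c s)) := by simp only [φ]; field_simp; ring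
    have hd : 0 < ‖c t - c s‖ := norm_pos_iff.2 hab
    have hcs : c s ∈ c '' Icc 0 L := ⟨s, ⟨hs, (hst.trans ht).le⟩, rfl⟩
    have hct : c t ∈ c '' Icc 0 L := ⟨t, ⟨hs.trans hst.le, ht.le⟩, rfl⟩
    have m1 := hmax z hz (c t) hct
    have m2 := hmax z hz (c s) hcs
    rw [dist_eq_norm, dist_comm (c s), dist_eq_norm] at m1 m2
    rw [e1, e2, norm_mul, norm_mul, norm_div, norm_div]
    have m1' := (div_le_one hd).2 m1
    have m2' := (div_le_one hd).2 m2
    constructor <;> simp <;> linarith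

end PlaneTopology

end

/-! ### Extending logarithms over arcs; arcs have empty interior -/

noncomputable section

namespace PlaneTopology

open Set Filter Topology Complex

/-- A continuous map from a compact space to ℂ is a quotient map onto its image. -/
theorem continuousOn_range_of_comp {A : Type*} [TopologicalSpace A] [CompactSpace A] {γ : A → ℂ}
    (hγ : Continuous γ) {g : ℂ → ℂ} (hg : Continuous (g ∘ γ)) : ContinuousOn g (range γ) := by
  have hq : IsQuotientMap (rangeFactorization γ) :=
    IsQuotientMap.of_surjective_continuous rangeFactorization_surjective
      (hγ.subtype_mk _)
  rw [continuousOn_iff_continuous_domRestrict, hq.continuous_iff]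
  exact hg

/-- Gluing a logarithm on a closed set with a logarithm along a curve. -/
theorem exists_log_union_range {K : Set ℂ} (hK : IsClosed K) {γ : I → ℂ} (hγ : Continuous γ)
    {f g : ℂ → ℂ} (hg : ContinuousOn g K) (he : ∀ z ∈ K, exp (g z) = f z)
    {l : I → ℂ} (hl : Continuous l) (hle : ∀ t, exp (l t) = f (γ t))
    (hKl : ∀ t, γ t ∈ K → l t = g (γ t)) (hll : ∀ t t', γ t = γ t' → l t = l t') :
    ∃ g' : ℂ → ℂ, ContinuousOn g' (K ∪ range γ) ∧ (∀ z ∈ K ∪ range γ, exp (g' z) = f z) ∧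
      ∀ z ∈ K, g' z = g z := by
  classical
  let g' : ℂ → ℂ := fun z => if z ∈ K then g z else if h : ∃ t, γ t = z then l h.choose else 0
  have h1 : ∀ z ∈ K, g' z = g z := fun z hz => by simp [g', hz]
  have h2 : ∀ t, g' (γ t) = l t := by
    intro t
    by_cases hz : γ t ∈ K
    · rw [h1 _ hz, hKl t hz]
    · have h : ∃ t', γ t' = γ t := ⟨t, rfl⟩
      simp only [g', hz, if_false, dif_pos h]
      exact hll _ _ h.choose_spec
  refine ⟨g', ?_, ?_, h1⟩
  · refine ContinuousOn.union_of_isClosed (hg.congr h1) (continuousOn_range_of_comp hγ ?_) hK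
      (isCompact_range hγ).isClosed
    have : g' ∘ γ = l := funext h2
    rwa [this]
  · rintro z (hz | ⟨t, rfl⟩)
    · rw [h1 z hz, he z hz]
    · rw [h2, hle]

/-- Logarithms extend over pendant arcs. The arc is a part of the curve `γ`, cut out by a retraction
`r` of the unit interval. -/
theorem HasLogOn.union_pendant {K : Set ℂ} (hK : IsClosed K) {γ : I → ℂ} (hγ : Continuous γ)
    {r : I → I} (hr : Continuous r) (hrr : ∀ u, r (r u) = r u) (hinj : InjOn γ (range r))
    {a : I} (ha : r a = a) (h0 : γ a ∈ K) (h1 : ∀ u, γ (r u) ∈ K → r u = a) {f : ℂ → ℂ}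
    (hf : HasLogOn f K) (hfγ : Continuous fun u => f (γ (r u))) (hf0 : ∀ u, f (γ (r u)) ≠ 0) :
    HasLogOn f (K ∪ range (γ ∘ r)) := by
  obtain ⟨g, hg, he⟩ := hf
  -- The arc meets K only in γ a, so a lift that starts there with the value of g has no further
  -- condition to satisfy.
  obtain ⟨l, hl, hl0, hle⟩ := exists_continuous_log_unitInterval hfγ hf0 a
    (c := g (γ a)) (by rw [he _ h0, ha])
  obtain ⟨g', c, e, -⟩ := exists_log_union_range hK (hγ.comp hr) hg he (hl.comp hr)
    (fun t => by simp [hle, hrr])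
    (fun t ht => by simp only [Function.comp_apply]; rw [h1 t ht, hl0])
    (fun t t' h => congrArg l (hinj ⟨t, rfl⟩ ⟨t', rfl⟩ h))
  exact ⟨g', c, e⟩

theorem isPreconnected_ball_sdiff_center (x : ℂ) (ε : ℝ) :
    IsPreconnected (Metric.ball x ε \ {x}) := by
  have : Metric.ball x ε \ {x} =
      (fun y : ℝ × ℝ => x + (y.1 : ℂ) * exp (y.2 * Complex.I)) '' (Ioo 0 ε ×ˢ univ) := by
    ext z
    simp only [Set.mem_sdiff, Metric.mem_ball, mem_singleton_iff, mem_image, mem_prod,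
      mem_Ioo, mem_univ, and_true, Prod.exists]
    constructor
    · rintro ⟨h1, h2⟩
      rw [dist_eq_norm] at h1
      refine ⟨‖z - x‖, arg (z - x), ⟨norm_pos_iff.2 (sub_ne_zero.2 h2), h1⟩, ?_⟩
      rw [norm_mul_exp_arg_mul_I, add_sub_cancel]
    · rintro ⟨a, b, h, rfl⟩
      refine ⟨?_, fun h' => ?_⟩
      · rw [dist_eq_norm, add_sub_cancel_left, norm_mul, norm_exp_ofReal_mul_I, mul_one, norm_real,
          Real.norm_of_nonneg h.1.le]
        exact h.2
      · simp [h.1.ne'] at h'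
  rw [this]
  refine IsPreconnected.image (isPreconnected_Ioo.prod isPreconnected_univ) _ ?_
  fun_prop

/-- An arc has no interior points. -/
theorem interior_range_eq_empty_of_injOn {γ : I → ℂ} (hγ : Continuous γ)
    (hinj : InjOn γ (Ioo 0 1)) : interior (range γ) = ∅ := by
  by_contra hne
  have hfin : ({γ 0, γ 1} : Set ℂ).Finite := by simp
  have hopen : IsOpen (interior (range γ) \ {γ 0, γ 1}) :=
    isOpen_interior.sdiff hfin.isClosed
  have hne' : (interior (range γ) \ {γ 0, γ 1}).Nonempty := by
    rw [nonempty_iff_ne_empty]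
    intro h
    have hsub : interior (range γ) ⊆ {γ 0, γ 1} := sdiff_eq_empty.1 h
    obtain ⟨x, hx⟩ := nonempty_iff_ne_empty.2 hne
    have : ({γ 0, γ 1} : Set ℂ) ∈ 𝓝 x := mem_of_superset (isOpen_interior.mem_nhds hx) hsub
    exact infinite_of_mem_nhds x this hfin
  have hIoo : ∀ t, γ t ∈ interior (range γ) \ {γ 0, γ 1} → t ∈ Ioo (0 : I) 1 := by
    intro t ht
    have h2 := ht.2
    simp only [mem_insert_iff, mem_singleton_iff, not_or] at h2
    exact ⟨lt_of_le_of_ne unitInterval.nonneg' fun h => h2.1 (congrArg γ h.symm),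
      lt_of_le_of_ne unitInterval.le_one' fun h => h2.2 (congrArg γ h)⟩
  obtain ⟨x, hx⟩ := hne'
  obtain ⟨t, rfl⟩ := interior_subset hx.1
  have ht := hIoo t hx
  obtain ⟨ε, hε, hb⟩ := Metric.isOpen_iff.1 hopen _ hx
  have hev : ∀ᶠ s in 𝓝 t, γ s ∈ Metric.ball (γ t) ε ∧ s ∈ Ioo (0 : I) 1 :=
    (hγ.continuousAt.eventually_mem (Metric.ball_mem_nhds _ hε)).and (isOpen_Ioo.mem_nhds ht)
  obtain ⟨u, hut, hu⟩ := (mem_nhds_iff_exists_Ioo_subset' ⟨0, ht.1⟩ ⟨1, ht.2⟩).1 hev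
  -- The punctured disc is connected, but the two compact halves of the arc cover it and could meet
  -- in the disc only at its centre.
  have hcov : Metric.ball (γ t) ε \ {γ t} ⊆ γ '' Iic t ∪ γ '' Ici t := by
    rw [← image_union, Iic_union_Ici, image_univ]
    exact fun z hz => interior_subset (hb hz.1).1
  obtain ⟨hut, hu⟩ := hu
  obtain ⟨s₁, hs₁, hs₁'⟩ := exists_between hut.1
  obtain ⟨s₂, hs₂, hs₂'⟩ := exists_between hut.2
  have m₁ := hu ⟨hs₁, hs₁'.trans hut.2⟩
  have m₂ := hu ⟨hut.1.trans hs₂, hs₂'⟩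
  have n₁ : γ s₁ ≠ γ t := fun h => hs₁'.ne (hinj m₁.2 ht h)
  have n₂ : γ s₂ ≠ γ t := fun h => hs₂.ne' (hinj m₂.2 ht h)
  obtain ⟨z, hz, ⟨r₁, hr₁, hz₁⟩, ⟨r₂, hr₂, hz₂⟩⟩ :=
    isPreconnected_closed_iff.1 (isPreconnected_ball_sdiff_center (γ t) ε) _ _
    (isClosed_Iic.isCompact.image hγ).isClosed (isClosed_Ici.isCompact.image hγ).isClosed hcov
    ⟨γ s₁, ⟨m₁.1, n₁⟩, s₁, hs₁'.le, rfl⟩ ⟨γ s₂, ⟨m₂.1, n₂⟩, s₂, hs₂.le, rfl⟩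
  have i₁ := hIoo r₁ (by rw [hz₁]; exact hb hz.1)
  have i₂ := hIoo r₂ (by rw [hz₂]; exact hb hz.1)
  have : r₁ = r₂ := hinj i₁ i₂ (hz₁.trans hz₂.symm)
  have : r₁ = t := le_antisymm hr₁ (this ▸ hr₂)
  exact hz.2 (by rw [← hz₁, this]; rfl)

end PlaneTopology

end

/-! ### The faces of a drawing and their boundary edges -/

noncomputable section

namespace Graph

namespace PlaneDrawing

open Set Filter Topology PlaneTopology

variable {α β : Type*} {G : Graph α β} (D : PlaneDrawing G)

/-- The points of the vertices together with the curves of the edges in `S`. -/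
def supportOn (S : Set β) : Set ℂ := D.point '' V(G) ∪ ⋃ e ∈ S, range (D.curve e)

/-- The curve of an edge without its ends. -/
def openEdge (e : β) : Set ℂ := D.curve e '' Ioo 0 1

variable {D} {e : β} {S T : Set β} {F F' : Set ℂ} {x z : ℂ}

theorem supportOn_mono (h : S ⊆ T) : D.supportOn S ⊆ D.supportOn T :=
  union_subset_union_right _ (biUnion_subset_biUnion_left h)

theorem point_mem_supportOn {v : α} (hv : v ∈ V(G)) : D.point v ∈ D.supportOn S :=
  Or.inl ⟨v, hv, rfl⟩

theorem curve_mem_supportOn (he : e ∈ S) (t : I) : D.curve e t ∈ D.supportOn S :=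
  Or.inr (mem_biUnion he ⟨t, rfl⟩)

theorem curve_zero_mem (he : e ∈ E(G)) : D.curve e 0 ∈ D.point '' V(G) := by
  obtain ⟨x, y, h, h0, -⟩ := D.curve_ends e he
  exact ⟨x, h.left_mem, h0.symm⟩

theorem curve_one_mem (he : e ∈ E(G)) : D.curve e 1 ∈ D.point '' V(G) := by
  obtain ⟨x, y, h, -, h1⟩ := D.curve_ends e he
  exact ⟨y, h.right_mem, h1.symm⟩

theorem eq_zero_or_mem_Ioo_or_eq_one (t : I) : t = 0 ∨ t ∈ Ioo (0 : I) 1 ∨ t = 1 := by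
  rcases (unitInterval.nonneg' (t := t)).eq_or_lt with h | h
  · exact Or.inl h.symm
  rcases (unitInterval.le_one' (t := t)).eq_or_lt with h' | h'
  · exact Or.inr (Or.inr h')
  · exact Or.inr (Or.inl ⟨h, h'⟩)

theorem mem_of_mem_range_curve (he : e ∈ E(G)) (hz : z ∈ range (D.curve e)) :
    z ∈ D.openEdge e ∨ z ∈ D.point '' V(G) := by
  obtain ⟨t, rfl⟩ := hz
  rcases eq_zero_or_mem_Ioo_or_eq_one t with rfl | h | rfl
  · exact Or.inr (curve_zero_mem he)
  · exact Or.inl ⟨t, h, rfl⟩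
  · exact Or.inr (curve_one_mem he)

theorem openEdge_subset_range : D.openEdge e ⊆ range (D.curve e) := image_subset_range _ _

theorem isPreconnected_openEdge (he : e ∈ E(G)) : IsPreconnected (D.openEdge e) :=
  isPreconnected_Ioo.image _ (D.curve_continuous e he).continuousOn

theorem openEdge_nonempty : (D.openEdge e).Nonempty :=
  (nonempty_Ioo.2 (zero_lt_one' I)).image _

theorem notMem_point_of_mem_openEdge (he : e ∈ E(G)) (hz : z ∈ D.openEdge e) :
    z ∉ D.point '' V(G) := by
  obtain ⟨t, ht, rfl⟩ := hz
  rintro ⟨v, hv, h⟩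
  exact D.curve_ne_point e he t ht v hv h.symm

theorem disjoint_openEdge_range {e' : β} (he : e ∈ E(G)) (he' : e' ∈ E(G)) (hne : e ≠ e') :
    Disjoint (D.openEdge e) (range (D.curve e')) := by
  rw [disjoint_left]
  intro z hz hz'
  rcases mem_of_mem_range_curve he' hz' with h | h
  · exact disjoint_left.1 (D.curve_disjoint e he e' he' hne) hz h
  · exact notMem_point_of_mem_openEdge he hz h

theorem disjoint_openEdge_supportOn (he : e ∈ E(G)) (hS : S ⊆ E(G)) (heS : e ∉ S) :
    Disjoint (D.openEdge e) (D.supportOn S) := by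
  rw [disjoint_left]
  rintro z hz (h | h)
  · exact notMem_point_of_mem_openEdge he hz h
  · obtain ⟨e', he', h⟩ := mem_iUnion₂.1 h
    exact disjoint_left.1
      (disjoint_openEdge_range he (hS he') (fun h => heS (h ▸ he'))) hz h

theorem supportOn_insert : D.supportOn (insert e S) = D.supportOn S ∪ range (D.curve e) := by
  rw [supportOn, biUnion_insert, supportOn, union_assoc, union_comm (range _)]

theorem isCompact_supportOn (hV : V(G).Finite) (hE : E(G).Finite) (hS : S ⊆ E(G)) :
    IsCompact (D.supportOn S) :=
  (hV.image _).isCompact.union ((hE.subset hS).isCompact_biUnion fun e he =>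
    isCompact_range (D.curve_continuous e (hS he)))

theorem isCompact_support (hV : V(G).Finite) (hE : E(G).Finite) : IsCompact D.support :=
  isCompact_supportOn hV hE Subset.rfl

theorem mem_openEdge_of_mem_supportOn (hS : S ⊆ E(G)) (hz : z ∈ D.supportOn S)
    (hz' : z ∉ D.supportOn T) : ∃ e ∈ S, e ∉ T ∧ z ∈ D.openEdge e := by
  rcases hz with h | h
  · exact absurd (Or.inl h) hz'
  · obtain ⟨e, he, h⟩ := mem_iUnion₂.1 h
    rcases mem_of_mem_range_curve (hS he) h with h' | h'
    · exact ⟨e, he, fun heT => hz' (Or.inr (mem_biUnion heT h)), h'⟩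
    · exact absurd (Or.inl h') hz'

/-! ### Faces -/

theorem IsFace.eq_of_mem (hF : D.IsFace F) (hz : z ∈ F) :
    F = connectedComponentIn D.supportᶜ z := by
  obtain ⟨w, -, rfl⟩ := hF
  exact connectedComponentIn_eq hz

theorem IsFace.eq_of_mem_of_mem (hF : D.IsFace F) (hF' : D.IsFace F') (hz : z ∈ F)
    (hz' : z ∈ F') : F = F' := by
  rw [hF.eq_of_mem hz, hF'.eq_of_mem hz']

theorem IsFace.subset (hF : D.IsFace F) : F ⊆ D.supportᶜ := by
  obtain ⟨w, -, rfl⟩ := hF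
  exact connectedComponentIn_subset _ _

theorem IsFace.nonempty (hF : D.IsFace F) : F.Nonempty := by
  obtain ⟨w, hw, rfl⟩ := hF
  exact ⟨w, mem_connectedComponentIn hw⟩

theorem IsFace.isPreconnected (hF : D.IsFace F) : IsPreconnected F := by
  obtain ⟨w, -, rfl⟩ := hF
  exact isPreconnected_connectedComponentIn

theorem IsFace.isOpen (hV : V(G).Finite) (hE : E(G).Finite) (hF : D.IsFace F) : IsOpen F := by
  obtain ⟨w, -, rfl⟩ := hF
  exact (isCompact_support hV hE).isClosed.isOpen_compl.connectedComponentIn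

theorem isFace_connectedComponentIn (hz : z ∉ D.support) :
    D.IsFace (connectedComponentIn D.supportᶜ z) := ⟨z, hz, rfl⟩

theorem interior_support (hV : V(G).Finite) (hE : E(G).Finite) : interior D.support = ∅ := by
  have h1 : interior (D.point '' V(G)) = ∅ := interior_eq_empty_iff_dense_compl.2
    ((hV.image _).countable.dense_compl ℂ)
  have key : ∀ S : Set β, S.Finite → S ⊆ E(G) → interior (D.supportOn S) = ∅ := by
    intro S hS
    induction S, hS using Set.Finite.induction_on with
    | empty => intro _; simpa [supportOn] using h1
    | @insert e S _ _ ih =>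
      intro hS
      have hS' := (insert_subset_iff.1 hS).2
      have he := (insert_subset_iff.1 hS).1
      rw [supportOn_insert, interior_union_isClosed_of_interior_empty
        (isCompact_supportOn hV hE hS').isClosed
        (interior_range_eq_empty_of_injOn (D.curve_continuous e he) (D.curve_injOn e he)), ih hS']
  exact key _ hE Subset.rfl

theorem dense_compl_support (hV : V(G).Finite) (hE : E(G).Finite) : Dense D.supportᶜ :=
  interior_eq_empty_iff_dense_compl.1 (interior_support hV hE)

/-! ### Logarithms on drawings -/

/-- The two ends of a loop coincide, so injectivity is available only after dropping one end of the
parameter interval. -/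
theorem injOn_curve_Iio (he : e ∈ E(G)) : InjOn (D.curve e) (Iio 1) := by
  have key : ∀ t ∈ Iio (1 : I), D.curve e 0 = D.curve e t → 0 = t := by
    intro t ht h
    rcases eq_zero_or_mem_Ioo_or_eq_one t with h' | h' | h'
    · exact h'.symm
    · exact absurd (h ▸ curve_zero_mem he) (notMem_point_of_mem_openEdge he ⟨t, h', rfl⟩)
    · exact absurd h' (ne_of_lt ht)
  intro s hs t ht h
  rcases eq_zero_or_mem_Ioo_or_eq_one s with rfl | hs' | hs'
  · exact key t ht h
  · rcases eq_zero_or_mem_Ioo_or_eq_one t with rfl | ht' | ht'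
    · exact (key s hs h.symm).symm
    · exact D.curve_injOn e he hs' ht' h
    · exact absurd ht' (ne_of_lt ht)
  · exact absurd hs' (ne_of_lt hs)

theorem injOn_curve_Ioi (he : e ∈ E(G)) : InjOn (D.curve e) (Ioi 0) := by
  have key : ∀ t ∈ Ioi (0 : I), D.curve e 1 = D.curve e t → 1 = t := by
    intro t ht h
    rcases eq_zero_or_mem_Ioo_or_eq_one t with h' | h' | h'
    · exact absurd h' (ne_of_gt ht)
    · exact absurd (h ▸ curve_one_mem he) (notMem_point_of_mem_openEdge he ⟨t, h', rfl⟩)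
    · exact h'.symm
  intro s hs t ht h
  rcases eq_zero_or_mem_Ioo_or_eq_one s with hs' | hs' | rfl
  · exact absurd hs' (ne_of_gt hs)
  · rcases eq_zero_or_mem_Ioo_or_eq_one t with ht' | ht' | rfl
    · exact absurd ht' (ne_of_gt ht)
    · exact D.curve_injOn e he hs' ht' h
    · exact (key s hs h.symm).symm
  · exact key t ht h

/-- A logarithm extends over an edge if the lift along the edge closes up. -/
theorem exists_log_insert (hK : IsClosed (D.supportOn S)) (hS : S ⊆ E(G)) (he : e ∈ E(G))
    (heS : e ∉ S) {f g : ℂ → ℂ} (hg : ContinuousOn g (D.supportOn S))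
    (hgf : ∀ z ∈ D.supportOn S, Complex.exp (g z) = f z) {l : I → ℂ} (hl : Continuous l)
    (hle : ∀ t, Complex.exp (l t) = f (D.curve e t)) (h0 : l 0 = g (D.curve e 0))
    (h1 : l 1 = g (D.curve e 1)) :
    ∃ g' : ℂ → ℂ, ContinuousOn g' (D.supportOn (insert e S)) ∧
      (∀ z ∈ D.supportOn (insert e S), Complex.exp (g' z) = f z) ∧
      ∀ z ∈ D.supportOn S, g' z = g z := by
  rw [supportOn_insert]
  have hKl : ∀ t, D.curve e t ∈ D.supportOn S → l t = g (D.curve e t) := by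
    intro t ht
    rcases eq_zero_or_mem_Ioo_or_eq_one t with rfl | h | rfl
    · exact h0
    · exact absurd ht (disjoint_left.1 (disjoint_openEdge_supportOn he hS heS) ⟨t, h, rfl⟩)
    · exact h1
  refine exists_log_union_range hK (D.curve_continuous e he) hg hgf hl hle hKl ?_
  intro s t h
  by_cases hs : D.curve e s ∈ D.supportOn S
  · rw [hKl s hs, hKl t (h ▸ hs), h]
  · have key : ∀ r, D.curve e r ∉ D.supportOn S → r ∈ Iio (1 : I) := by
      intro r hr
      refine lt_of_le_of_ne unitInterval.le_one' ?_
      rintro rfl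
      exact hr (Or.inl (curve_one_mem he))
    rw [injOn_curve_Iio he (key s hs) (key t (h ▸ hs)) h]

/-- Removing a subarc of an edge from the drawing does not cut the face that results from the
deletion of the edge. -/
theorem connectedComponentIn_eq_of_pendant (hV : V(G).Finite) (hE : E(G).Finite) (hS : S ⊆ E(G))
    (he : e ∈ E(G)) (heS : e ∉ S) {s t : I} (hs : s ∈ Ioo (0 : I) 1) (ht : t ∈ Ioo (0 : I) 1)
    (hst : s < t) {p q : ℂ}
    (hp : p ∉ D.supportOn S ∪ D.curve e '' Iic s ∪ D.curve e '' Ici t)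
    (hq : q ∉ D.supportOn S ∪ D.curve e '' Iic s ∪ D.curve e '' Ici t)
    (h : connectedComponentIn (D.supportOn S)ᶜ p = connectedComponentIn (D.supportOn S)ᶜ q) :
    connectedComponentIn (D.supportOn S ∪ D.curve e '' Iic s ∪ D.curve e '' Ici t)ᶜ p =
    connectedComponentIn (D.supportOn S ∪ D.curve e '' Iic s ∪ D.curve e '' Ici t)ᶜ q := by
  have hK := isCompact_supportOn (D := D) hV hE hS
  have hc := D.curve_continuous e he
  have hpS : p ∉ D.supportOn S := fun h => hp (Or.inl (Or.inl h))
  have hqS : q ∉ D.supportOn S := fun h => hq (Or.inl (Or.inl h))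
  have hr₁ : range (D.curve e ∘ fun u => min s u) = D.curve e '' Iic s := by
    rw [range_comp]
    congr 1
    ext u
    exact ⟨fun ⟨v, hv⟩ => hv ▸ mem_Iic.2 (min_le_left s v), fun hu => ⟨u, min_eq_right hu⟩⟩
  have hr₂ : range (D.curve e ∘ fun u => max t u) = D.curve e '' Ici t := by
    rw [range_comp]
    congr 1
    ext u
    exact ⟨fun ⟨v, hv⟩ => hv ▸ mem_Ici.2 (le_max_left t v), fun hu => ⟨u, max_eq_right hu⟩⟩
  rw [← hr₁] at hp hq ⊢
  rw [← hr₂] at hp hq ⊢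
  have hsI : range (fun u => min s u) ⊆ Iio 1 := by
    rintro _ ⟨u, rfl⟩
    exact (min_le_left s u).trans_lt hs.2
  have htI : range (fun u => max t u) ⊆ Ioi 0 := by
    rintro _ ⟨u, rfl⟩
    exact ht.1.trans_le (le_max_left t u)
  have hnS : ∀ u, D.curve e u ∈ D.supportOn S → u = 0 ∨ u = 1 := by
    intro u hu
    rcases eq_zero_or_mem_Ioo_or_eq_one u with h | h | h
    · exact Or.inl h
    · exact absurd hu (disjoint_left.1 (disjoint_openEdge_supportOn he hS heS) ⟨u, h, rfl⟩)
    · exact Or.inr h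
  have hcont : ∀ r : I → I, Continuous r → (∀ u, p ≠ D.curve e (r u)) →
      (∀ u, q ≠ D.curve e (r u)) →
      (Continuous fun u => (D.curve e (r u) - p) / (D.curve e (r u) - q)) ∧
      ∀ u, (D.curve e (r u) - p) / (D.curve e (r u) - q) ≠ 0 := by
    intro r hr hp hq
    refine ⟨?_, fun u => div_ne_zero (sub_ne_zero.2 (hp u).symm) (sub_ne_zero.2 (hq u).symm)⟩
    have h3 : Continuous fun u => D.curve e (r u) := hc.comp hr
    exact (h3.sub continuous_const).div (h3.sub continuous_const)
      fun u => sub_ne_zero.2 (hq u).symm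
  have hc₁ := hcont (fun u => min s u) (by fun_prop)
    (fun u h => hp (Or.inl (Or.inr ⟨u, h.symm⟩))) (fun u h => hq (Or.inl (Or.inr ⟨u, h.symm⟩)))
  have hc₂ := hcont (fun u => max t u) (by fun_prop)
    (fun u h => hp (Or.inr ⟨u, h.symm⟩)) (fun u h => hq (Or.inr ⟨u, h.symm⟩))
  have hd : Disjoint (connectedComponentIn (D.supportOn S)ᶜ p) (D.supportOn S) :=
    disjoint_left.2 fun z hz => connectedComponentIn_subset _ _ hz
  -- The logarithm for p and q on the drawing of S extends over the two remaining pieces of e, which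
  -- are pendant arcs; by Eilenberg's criterion p and q stay together.
  have h0 := hasLogOn_of_isPreconnected hK isPreconnected_connectedComponentIn hd
    (mem_connectedComponentIn hpS) (by rw [h]; exact mem_connectedComponentIn hqS)
  have hK₁ : IsCompact (D.supportOn S ∪ range (D.curve e ∘ fun u => min s u)) :=
    hK.union (isCompact_range (hc.comp (by fun_prop)))
  have h1 := h0.union_pendant hK.isClosed hc (r := fun u => min s u) (by fun_prop)
    (fun u => by simp) ((injOn_curve_Iio he).mono hsI) (a := 0) (min_eq_right hs.1.le)
    (Or.inl (curve_zero_mem he))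
    (fun u hu => (hnS _ hu).resolve_right (ne_of_lt (hsI ⟨u, rfl⟩))) hc₁.1 hc₁.2
  have h2 := h1.union_pendant hK₁.isClosed hc (r := fun u => max t u) (by fun_prop)
    (fun u => by simp) ((injOn_curve_Ioi he).mono htI) (a := 1) (max_eq_right ht.2.le)
    (Or.inl (Or.inl (curve_one_mem he)))
    (fun u hu => by
      rcases hu with hu | ⟨v, hv⟩
      · exact (hnS _ hu).resolve_left (ne_of_gt (htI ⟨u, rfl⟩))
      -- The two pieces can meet only if e is a loop, at its vertex, which the second piece has at
      -- parameter 1.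
      · have h3 : D.curve e (min s v) = D.curve e (max t u) := hv
        have h4 : min s v < max t u :=
          (min_le_left s v).trans_lt (hst.trans_le (le_max_left t u))
        rcases eq_zero_or_mem_Ioo_or_eq_one (max t u) with h5 | h5 | h5
        · exact absurd h5 (ne_of_gt (htI ⟨u, rfl⟩))
        · exact absurd (injOn_curve_Iio he (hsI ⟨v, rfl⟩) h5.2 h3) h4.ne
        · exact h5)
    hc₂.1 hc₂.2
  exact connectedComponentIn_eq_of_hasLogOn
    (hK₁.union (isCompact_range (hc.comp (by fun_prop)))) hp hq h2

/-! ### Faces along an edge -/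

/-- The component of the complement of the drawing without `e` in which `e` is drawn. -/
def edgeRegion (D : PlaneDrawing G) (e : β) : Set ℂ :=
  ⋃ x ∈ D.openEdge e, connectedComponentIn (D.supportOn (E(G) \ {e}))ᶜ x

theorem disjoint_openEdge_supportOn_sdiff (he : e ∈ E(G)) :
    Disjoint (D.openEdge e) (D.supportOn (E(G) \ {e})) :=
  disjoint_openEdge_supportOn he sdiff_subset (fun h => h.2 rfl)

theorem edgeRegion_eq (he : e ∈ E(G)) (hx : x ∈ D.openEdge e) :
    D.edgeRegion e = connectedComponentIn (D.supportOn (E(G) \ {e}))ᶜ x := by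
  refine Subset.antisymm (iUnion₂_subset fun y hy => ?_)
    (subset_biUnion_of_mem (u := fun x => connectedComponentIn (D.supportOn (E(G) \ {e}))ᶜ x) hx)
  have h := (isPreconnected_openEdge he).subset_connectedComponentIn hx
    (disjoint_openEdge_supportOn_sdiff he).subset_compl_right hy
  rw [connectedComponentIn_eq h]

theorem openEdge_subset_edgeRegion (he : e ∈ E(G)) : D.openEdge e ⊆ D.edgeRegion e :=
  fun x hx => by
    rw [edgeRegion_eq he hx]
    exact mem_connectedComponentIn (disjoint_left.1 (disjoint_openEdge_supportOn_sdiff he) hx)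

theorem isOpen_edgeRegion (hV : V(G).Finite) (hE : E(G).Finite) : IsOpen (D.edgeRegion e) :=
  isOpen_biUnion fun _ _ =>
    (isCompact_supportOn hV hE sdiff_subset).isClosed.isOpen_compl.connectedComponentIn

theorem edgeRegion_subset : D.edgeRegion e ⊆ (D.supportOn (E(G) \ {e}))ᶜ :=
  iUnion₂_subset fun _ _ => connectedComponentIn_subset _ _

theorem supportOn_sdiff_union (he : e ∈ E(G)) :
    D.support = D.supportOn (E(G) \ {e}) ∪ range (D.curve e) := by
  rw [← supportOn_insert, insert_sdiff_singleton, insert_eq_of_mem he]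
  rfl

theorem IsBoundaryEdge.openEdge_subset_closure (h : D.IsBoundaryEdge e F) :
    D.openEdge e ⊆ closure F :=
  openEdge_subset_range.trans (h.2.trans frontier_subset_closure)

theorem IsBoundaryEdge.subset_edgeRegion (hV : V(G).Finite) (hE : E(G).Finite)
    (h : D.IsBoundaryEdge e F) (hF : D.IsFace F) : F ⊆ D.edgeRegion e := by
  obtain ⟨x, hx⟩ := openEdge_nonempty (D := D) (e := e)
  obtain ⟨y, hyU, hyF⟩ := mem_closure_iff.1 (h.openEdge_subset_closure hx) _
    (isOpen_edgeRegion hV hE) (openEdge_subset_edgeRegion h.1 hx)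
  rw [edgeRegion_eq h.1 hx] at hyU ⊢
  rw [connectedComponentIn_eq hyU]
  exact hF.isPreconnected.subset_connectedComponentIn hyF
    (hF.subset.trans (compl_subset_compl.2 (supportOn_mono sdiff_subset)))

/-- Suppose that F misses a neighbourhood W of a point of e. Delete from the drawing a subarc of e
around that point inside W. The remaining pieces of e are pendant, so the point and F lie in one
component of the new complement. That component is covered by F and the exterior of F, as the
deleted subarc is not in the closure of F; hence it is contained in F, although it contains a point
of e. -/
theorem isBoundaryEdge_of_mem_edgeRegion (hV : V(G).Finite) (hE : E(G).Finite) (he : e ∈ E(G))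
    (hF : D.IsFace F) (hz : z ∈ F) (hzU : z ∈ D.edgeRegion e) : D.IsBoundaryEdge e F := by
  have hc := D.curve_continuous e he
  have hK := isCompact_support (D := D) hV hE
  have hopen : D.openEdge e ⊆ closure F := by
    rintro x ⟨t, ht, rfl⟩
    rw [mem_closure_iff]
    intro W hW hxW
    obtain ⟨a, b, ⟨hat, htb⟩, hab⟩ := (mem_nhds_iff_exists_Ioo_subset' ⟨0, ht.1⟩ ⟨1, ht.2⟩).1
      ((hW.preimage hc).mem_nhds hxW)
    -- The curve between the parameters s₁ and s₂ is the subarc inside W that gets deleted.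
    obtain ⟨s₁, has₁, hs₁t⟩ := exists_between (max_lt hat ht.1)
    obtain ⟨s₂, hts₂, hs₂b⟩ := exists_between (lt_min htb ht.2)
    obtain ⟨ha₁, h0₁⟩ := max_lt_iff.1 has₁
    obtain ⟨hb₂, h1₂⟩ := lt_min_iff.1 hs₂b
    have hS : E(G) \ {e} ⊆ E(G) := sdiff_subset
    have heS : e ∉ E(G) \ {e} := fun h => h.2 rfl
    by_contra hFW
    have hFW : ∀ y ∈ W, y ∉ F := fun y h1 h2 => hFW ⟨y, h1, h2⟩
    let K : Set ℂ := D.supportOn (E(G) \ {e}) ∪ D.curve e '' Iic s₁ ∪ D.curve e '' Ici s₂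
    have hKsub : K ⊆ D.support := by
      rw [supportOn_sdiff_union he]
      rintro y ((h | h) | h)
      · exact Or.inl h
      · exact Or.inr (image_subset_range _ _ h)
      · exact Or.inr (image_subset_range _ _ h)
    have hxK : D.curve e t ∉ K := by
      rintro ((h | ⟨u, hu, h⟩) | ⟨u, hu, h⟩)
      · exact disjoint_left.1 (disjoint_openEdge_supportOn_sdiff he) ⟨t, ht, rfl⟩ h
      · exact absurd (injOn_curve_Iio he ((hu.trans_lt hs₁t).trans ht.2) ht.2 h)
          (hu.trans_lt hs₁t).ne
      · exact absurd (injOn_curve_Ioi he (ht.1.trans (hts₂.trans_le hu)) ht.1 h)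
          (hts₂.trans_le hu).ne'
    have hzK : z ∉ K := fun h => hF.subset hz (hKsub h)
    rw [edgeRegion_eq he ⟨t, ht, rfl⟩] at hzU
    have hcomp := connectedComponentIn_eq_of_pendant hV hE hS he heS
      ⟨h0₁, hs₁t.trans ht.2⟩ ⟨ht.1.trans hts₂, h1₂⟩ (hs₁t.trans hts₂) hxK hzK
      (connectedComponentIn_eq hzU)
    have hsub : connectedComponentIn Kᶜ (D.curve e t) ⊆ F ∪ (closure F)ᶜ := by
      intro y hy
      by_contra hyF
      rw [mem_union, not_or, notMem_compl_iff] at hyF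
      have hyK : y ∈ D.support := by
        obtain ⟨w, hw, rfl⟩ := hF
        refine frontier_connectedComponentIn_compl_subset hK.isClosed w ?_
        rw [hK.isClosed.isOpen_compl.connectedComponentIn.frontier_eq]
        exact ⟨hyF.2, hyF.1⟩
      have hyK' : y ∉ K := connectedComponentIn_subset _ _ hy
      rw [supportOn_sdiff_union he] at hyK
      rcases hyK with h | ⟨u, rfl⟩
      · exact hyK' (Or.inl (Or.inl h))
      · have h1 : s₁ < u := not_le.1 fun h => hyK' (Or.inl (Or.inr ⟨u, h, rfl⟩))
        have h2 : u < s₂ := not_le.1 fun h => hyK' (Or.inr ⟨u, h, rfl⟩)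
        have huW : D.curve e u ∈ W := hab ⟨ha₁.trans h1, h2.trans hb₂⟩
        obtain ⟨y, hyW, hyF⟩ := mem_closure_iff.1 hyF.2 W hW huW
        exact hFW y hyW hyF
    have := isPreconnected_connectedComponentIn.subset_left_of_subset_union
      (hF.isOpen hV hE) isClosed_closure.isOpen_compl
      (disjoint_compl_right.mono_left subset_closure) hsub
      ⟨z, by rw [hcomp]; exact mem_connectedComponentIn hzK, hz⟩
    exact hF.subset (this (mem_connectedComponentIn hxK)) (Or.inr (mem_biUnion he ⟨t, rfl⟩))
  refine ⟨he, ?_⟩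
  have h1 : range (D.curve e) ⊆ closure F := by
    refine Subset.trans ?_ (closure_minimal hopen isClosed_closure)
    have h2 : closure (Ioo (0 : I) 1) = univ := by
      rw [closure_Ioo (zero_ne_one' I)]
      exact eq_univ_of_forall fun u => ⟨unitInterval.nonneg', unitInterval.le_one'⟩
    rw [← image_univ, ← h2]
    exact image_closure_subset_closure_image hc
  rw [(hF.isOpen hV hE).frontier_eq]
  rintro y hy
  exact ⟨h1 hy, fun h => hF.subset h (Or.inr (mem_biUnion he hy))⟩

theorem exists_isFace_inter_nonempty (hV : V(G).Finite) (hE : E(G).Finite) {W : Set ℂ}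
    (hW : IsOpen W) (hne : W.Nonempty) : ∃ F, D.IsFace F ∧ (F ∩ W).Nonempty := by
  obtain ⟨z, hzW, hz⟩ := (dense_compl_support (D := D) hV hE).inter_open_nonempty W hW hne
  exact ⟨_, isFace_connectedComponentIn hz, z, mem_connectedComponentIn hz, hzW⟩

/-- Every edge occurs in the boundary of some face. -/
theorem exists_isBoundaryEdge (hV : V(G).Finite) (hE : E(G).Finite) (he : e ∈ E(G)) :
    ∃ F, D.IsFace F ∧ D.IsBoundaryEdge e F := by
  obtain ⟨F, hF, z, hz, hzU⟩ := exists_isFace_inter_nonempty hV hE (isOpen_edgeRegion hV hE)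
    (openEdge_nonempty.mono (openEdge_subset_edgeRegion (D := D) he))
  exact ⟨F, hF, isBoundaryEdge_of_mem_edgeRegion hV hE he hF hz hzU⟩

theorem exists_intCast_eq_of_exp_eq {a b : ℂ} (h : Complex.exp a = Complex.exp b) :
    ∃ k : ℤ, a = b + k * (2 * Real.pi * Complex.I) := Complex.exp_eq_exp_iff_exists_int.1 h

/-- No edge occurs in the boundaries of three faces. -/
theorem eq_of_three_isBoundaryEdge (hV : V(G).Finite) (hE : E(G).Finite) {F₁ F₂ F₃ : Set ℂ}
    (hF₁ : D.IsFace F₁) (hF₂ : D.IsFace F₂) (hF₃ : D.IsFace F₃) (h₁ : D.IsBoundaryEdge e F₁)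
    (h₂ : D.IsBoundaryEdge e F₂) (h₃ : D.IsBoundaryEdge e F₃) : F₁ = F₂ ∨ F₁ = F₃ ∨ F₂ = F₃ := by
  by_contra! hne
  obtain ⟨p, hp⟩ := hF₁.nonempty
  obtain ⟨q, hq⟩ := hF₂.nonempty
  obtain ⟨r, hr⟩ := hF₃.nonempty
  have he := h₁.1
  have hc := D.curve_continuous e he
  have hK := isCompact_support (D := D) hV hE
  have hK' := isCompact_supportOn (D := D) hV hE (S := E(G) \ {e}) sdiff_subset
  obtain ⟨x, hx⟩ := openEdge_nonempty (D := D) (e := e)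
  have hpK := hF₁.subset hp
  have hqK := hF₂.subset hq
  have hrK := hF₃.subset hr
  rw [hF₁.eq_of_mem hp, hF₂.eq_of_mem hq, hF₃.eq_of_mem hr] at hne
  have hU : IsPreconnected (D.edgeRegion e) := by
    rw [edgeRegion_eq he hx]; exact isPreconnected_connectedComponentIn
  have hUd : Disjoint (D.edgeRegion e) (D.supportOn (E(G) \ {e})) :=
    disjoint_left.2 edgeRegion_subset
  have hpU := h₁.subset_edgeRegion hV hE hF₁ hp
  have hqU := h₂.subset_edgeRegion hV hE hF₂ hq
  have hrU := h₃.subset_edgeRegion hV hE hF₃ hr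
  -- Off e there is a logarithm for p and q, since both lie in the region of e. Lifting along e from
  -- its start, one integer a measures the failure to close up.
  have key : ∀ q, q ∈ D.supportᶜ → q ∈ D.edgeRegion e → ∃ (g : ℂ → ℂ) (l : I → ℂ) (a : ℤ),
      ContinuousOn g (D.supportOn (E(G) \ {e})) ∧
      (∀ z ∈ D.supportOn (E(G) \ {e}), Complex.exp (g z) = (z - p) / (z - q)) ∧ Continuous l ∧
      (∀ t, Complex.exp (l t) = (D.curve e t - p) / (D.curve e t - q)) ∧
      l 0 = g (D.curve e 0) ∧
      l 1 = g (D.curve e 1) + a * (2 * Real.pi * Complex.I) := by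
    intro q hqK hqU
    obtain ⟨g, hg, hge⟩ := hasLogOn_of_isPreconnected hK' hU hUd hpU hqU
    have hn : ∀ p ∈ D.supportᶜ, ∀ t, D.curve e t - p ≠ 0 := fun p hp t h => hp
      (by rw [← sub_eq_zero.1 h]; exact curve_mem_supportOn he t)
    obtain ⟨l, hl, hl0, hle⟩ := exists_continuous_log_unitInterval
      (f := fun t => (D.curve e t - p) / (D.curve e t - q))
      ((hc.sub continuous_const).div (hc.sub continuous_const) (hn q hqK))
      (fun t => div_ne_zero (hn p hpK t) (hn q hqK t)) 0
      (hge _ (Or.inl (curve_zero_mem he)))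
    obtain ⟨a, ha⟩ := exists_intCast_eq_of_exp_eq
      ((hle 1).trans (hge _ (Or.inl (curve_one_mem he))).symm)
    exact ⟨g, l, a, hg, hge, hl, hle, hl0, ha⟩
  obtain ⟨g, l, a, hg, hge, hl, hle, hl0, hl1⟩ := key q hqK hqU
  obtain ⟨g', l', a', hg', hge', hl', hle', hl0', hl1'⟩ := key r hrK hrU
  have hins : insert e (E(G) \ {e}) = E(G) := by
    rw [insert_sdiff_singleton, insert_eq_of_mem he]
  have hcomb : ∀ (m n : ℤ) (u v : ℂ), Complex.exp (m * u - n * v) =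
      Complex.exp u ^ m * (Complex.exp v ^ n)⁻¹ := fun m n u v => by
    rw [Complex.exp_sub, Complex.exp_int_mul, Complex.exp_int_mul, div_eq_mul_inv]
  -- With the coefficients a' and -a the two closing errors cancel, which yields a relation between
  -- three components.
  obtain ⟨g'', hg'', hge'', -⟩ := exists_log_insert hK'.isClosed sdiff_subset he (fun h => h.2 rfl)
    (f := fun z => ((z - p) / (z - q)) ^ a' * (((z - p) / (z - r)) ^ a)⁻¹)
    (g := fun z => a' * g z - a * g' z) (l := fun t => a' * l t - a * l' t)
    ((continuousOn_const.mul hg).sub (continuousOn_const.mul hg'))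
    (fun z hz => by rw [hcomb, hge z hz, hge' z hz])
    ((continuous_const.mul hl).sub (continuous_const.mul hl'))
    (fun t => by rw [hcomb, hle, hle'])
    (by simp only [hl0, hl0']) (by simp only [hl1, hl1']; ring)
  rw [hins] at hg'' hge''
  obtain ⟨ha, ha'⟩ := not_three_components hK hpK hqK hrK hne.1 hne.2.1 hne.2.2 ⟨g'', hg'', hge''⟩
  -- Now a = 0, so already the first logarithm closes up along e, which puts p and q into the same
  -- face.
  rw [ha, Int.cast_zero, zero_mul, add_zero] at hl1
  obtain ⟨g₃, hg₃, hge₃, -⟩ := exists_log_insert hK'.isClosed sdiff_subset he (fun h => h.2 rfl)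
    (f := fun z => (z - p) / (z - q)) hg hge hl hle hl0 hl1
  rw [hins] at hg₃ hge₃
  exact hne.1 (connectedComponentIn_eq_of_hasLogOn hK hpK hqK ⟨g₃, hg₃, hge₃⟩)

end PlaneDrawing

end Graph

end

/-! ### The dual graph; forests do not separate the plane, cycles do -/

noncomputable section

namespace Graph

/-- Every integral function on the edges in `S` is the coboundary of a function on the vertices. -/
def CoboundaryOnto {α β : Type*} (G : Graph α β) (S : Set β) : Prop :=
  ∀ (c : β → ℤ) (s t : β → α), (∀ e ∈ S, G.IsLink e (s e) (t e)) →
    ∃ m : α → ℤ, ∀ e ∈ S, m (t e) = m (s e) + c e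

namespace PlaneDrawing

open Set Filter Topology PlaneTopology

variable {α β : Type*} {G : Graph α β} {D : PlaneDrawing G}
variable {e : β} {S T : Set β} {F F' : Set ℂ} {x z : ℂ}

/-- The dual as defined has an edge for e only if the faces at e are exactly one or two; that there
are never three is `eq_of_three_isBoundaryEdge`. -/
theorem exists_dual_isLink (hV : V(G).Finite) (hE : E(G).Finite) (he : e ∈ E(G)) :
    ∃ F F', D.dual.IsLink e F F' := by
  obtain ⟨F, hF, hFe⟩ := exists_isBoundaryEdge (D := D) hV hE he
  by_cases h : ∃ F', D.IsFace F' ∧ D.IsBoundaryEdge e F' ∧ F' ≠ F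
  · obtain ⟨F', hF', hFe', hne⟩ := h
    refine ⟨F, F', he, hF, hF', fun H hH => ⟨fun hHe => ?_, ?_⟩⟩
    · rcases eq_of_three_isBoundaryEdge hV hE hF hF' hH hFe hFe' hHe with h | h | h
      · exact absurd h.symm hne
      · exact Or.inl h.symm
      · exact Or.inr h.symm
    · rintro (rfl | rfl) <;> assumption
  · push Not at h
    refine ⟨F, F, he, hF, hF, fun H hH => ⟨fun hHe => Or.inl (h H hH hHe), ?_⟩⟩
    rintro (rfl | rfl) <;> assumption

theorem isBoundaryEdge_left_of_isLink (h : D.dual.IsLink e F F') : D.IsBoundaryEdge e F :=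
  (h.2.2.2 F h.2.1).2 (Or.inl rfl)

theorem isBoundaryEdge_right_of_isLink (h : D.dual.IsLink e F F') : D.IsBoundaryEdge e F' :=
  isBoundaryEdge_left_of_isLink h.symm

theorem isLink_of_isBoundaryEdge (hV : V(G).Finite) (hE : E(G).Finite) (hF : D.IsFace F)
    (hF' : D.IsFace F') (h : D.IsBoundaryEdge e F) (h' : D.IsBoundaryEdge e F') (hne : F ≠ F') :
    D.dual.IsLink e F F' := by
  obtain ⟨H, H', hH⟩ := exists_dual_isLink (D := D) hV hE h.1
  have h1 := (hH.2.2.2 F hF).1 h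
  have h2 := (hH.2.2.2 F' hF').1 h'
  rcases h1 with rfl | rfl <;> rcases h2 with rfl | rfl
  · exact absurd rfl hne
  · exact hH
  · exact hH.symm
  · exact absurd rfl hne

/-- A set of faces that is closed under crossing the edges outside `S` contains all faces, if `S`
does not separate the plane. -/
theorem forall_face_mem_of_isPreconnected (hV : V(G).Finite) (hE : E(G).Finite)
    (hS : S ⊆ E(G)) (hc : IsPreconnected (D.supportOn S)ᶜ) {X : Set (Set ℂ)}
    (hX : ∀ e ∈ E(G) \ S, ∀ F F', D.dual.IsLink e F F' → F ∈ X → F' ∈ X)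
    (hF : D.IsFace F) (hFX : F ∈ X) (hF' : D.IsFace F') : F' ∈ X := by
  have hX' : ∀ e ∈ E(G) \ S, ∀ F F', D.IsFace F → D.IsFace F' → D.IsBoundaryEdge e F →
      D.IsBoundaryEdge e F' → F ∈ X → F' ∈ X := by
    intro e he F F' hF hF' h h' hFX
    by_cases hne : F = F'
    · rwa [← hne]
    · exact hX e he F F' (isLink_of_isBoundaryEdge hV hE hF hF' h h' hne) hFX
  -- Faces in X are glued along the edges outside S by adding the regions of these edges. The open
  -- sets for X and its complement cover the plane off the drawing of S. They are disjoint: faces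
  -- are dense, so an overlap would meet a face that belongs to both classes.
  let W : Set (Set ℂ) → Set ℂ := fun X =>
    (⋃ F ∈ {F | D.IsFace F ∧ F ∈ X}, F) ∪
      ⋃ e ∈ {e | e ∈ E(G) \ S ∧ ∃ F ∈ X, D.IsFace F ∧ D.IsBoundaryEdge e F}, D.edgeRegion e
  have hW : ∀ X, IsOpen (W X) := fun X =>
    (isOpen_biUnion fun F hF => hF.1.isOpen hV hE).union
      (isOpen_biUnion fun e _ => isOpen_edgeRegion hV hE)
  have hWX : ∀ X : Set (Set ℂ), (∀ e ∈ E(G) \ S, ∀ F F', D.IsFace F → D.IsFace F' →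
      D.IsBoundaryEdge e F → D.IsBoundaryEdge e F' → F ∈ X → F' ∈ X) →
      ∀ F, D.IsFace F → ∀ z ∈ F, z ∈ W X → F ∈ X := by
    rintro X hX F hF z hz (h | h)
    · obtain ⟨F', ⟨hF', hFX'⟩, hz'⟩ := mem_iUnion₂.1 h
      rwa [hF.eq_of_mem_of_mem hF' hz hz']
    · obtain ⟨e, ⟨he, F', hFX', hF', hFe'⟩, hz'⟩ := mem_iUnion₂.1 h
      exact hX e he F' F hF' hF hFe' (isBoundaryEdge_of_mem_edgeRegion hV hE he.1 hF hz hz') hFX'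
  have hXc : ∀ e ∈ E(G) \ S, ∀ F F', D.IsFace F → D.IsFace F' → D.IsBoundaryEdge e F →
      D.IsBoundaryEdge e F' → F ∈ Xᶜ → F' ∈ Xᶜ := fun e he F F' hF hF' h h' hFX hFX' =>
    hFX (hX' e he F' F hF' hF h' h hFX')
  have hdisj : Disjoint (W X) (W Xᶜ) := by
    rw [disjoint_iff_inter_eq_empty]
    by_contra hne
    obtain ⟨H, hH, z, hz, hz1, hz2⟩ := exists_isFace_inter_nonempty (D := D) hV hE
      ((hW X).inter (hW Xᶜ)) (nonempty_iff_ne_empty.2 hne)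
    exact hWX Xᶜ hXc H hH z hz hz2 (hWX X hX' H hH z hz hz1)
  have hcov : (D.supportOn S)ᶜ ⊆ W X ∪ W Xᶜ := by
    intro z hz
    by_cases hzK : z ∈ D.support
    · obtain ⟨e, he, heS, hze⟩ := mem_openEdge_of_mem_supportOn Subset.rfl hzK hz
      obtain ⟨H, hH, hHe⟩ := exists_isBoundaryEdge (D := D) hV hE he
      have hzU := openEdge_subset_edgeRegion he hze
      by_cases hHX : H ∈ X
      · exact Or.inl (Or.inr (mem_biUnion (show e ∈ {e | _} from ⟨⟨he, heS⟩, H, hHX, hH, hHe⟩) hzU))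
      · exact Or.inr (Or.inr (mem_biUnion (show e ∈ {e | _} from ⟨⟨he, heS⟩, H, hHX, hH, hHe⟩) hzU))
    · have hH := isFace_connectedComponentIn hzK
      have hzH := mem_connectedComponentIn (show z ∈ D.supportᶜ from hzK)
      by_cases hHX : connectedComponentIn D.supportᶜ z ∈ X
      · exact Or.inl (Or.inl (mem_biUnion (show _ ∈ {F | D.IsFace F ∧ F ∈ X} from ⟨hH, hHX⟩) hzH))
      · exact Or.inr (Or.inl (mem_biUnion (show _ ∈ {F | D.IsFace F ∧ F ∈ Xᶜ} from ⟨hH, hHX⟩) hzH))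
  have hsub : ∀ F, D.IsFace F → F ⊆ (D.supportOn S)ᶜ := fun F hF =>
    hF.subset.trans (compl_subset_compl.2 (supportOn_mono hS))
  obtain ⟨p, hp⟩ := hF.nonempty
  obtain ⟨q, hq⟩ := hF'.nonempty
  have := hc.subset_left_of_subset_union (hW X) (hW Xᶜ) hdisj hcov
    ⟨p, hsub F hF hp, Or.inl (mem_biUnion (show F ∈ {F | D.IsFace F ∧ F ∈ X} from ⟨hF, hFX⟩) hp)⟩
  exact hWX X hX' F' hF' q hq (this (hsub F' hF' hq))

/-- Logarithms on a drawing are put together from lifts along the edges. -/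
theorem hasLogOn_supportOn_of_lifts (hV : V(G).Finite) (hE : E(G).Finite) (hS : S ⊆ E(G))
    {f : ℂ → ℂ} {L : α → ℂ} (hL : ∀ v ∈ V(G), Complex.exp (L v) = f (D.point v))
    {l : β → I → ℂ} (hl : ∀ e ∈ S, Continuous (l e))
    (hle : ∀ e ∈ S, ∀ t, Complex.exp (l e t) = f (D.curve e t)) {s t : β → α}
    (hst : ∀ e ∈ S, G.IsLink e (s e) (t e)) (hs : ∀ e ∈ S, D.curve e 0 = D.point (s e))
    (ht : ∀ e ∈ S, D.curve e 1 = D.point (t e)) (hls : ∀ e ∈ S, l e 0 = L (s e))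
    (hlt : ∀ e ∈ S, l e 1 = L (t e)) : HasLogOn f (D.supportOn S) := by
  suffices ∃ g : ℂ → ℂ, ContinuousOn g (D.supportOn S) ∧
      (∀ z ∈ D.supportOn S, Complex.exp (g z) = f z) ∧ ∀ v ∈ V(G), g (D.point v) = L v from
    let ⟨g, h1, h2, _⟩ := this
    ⟨g, h1, h2⟩
  have hSf := hE.subset hS
  induction S, hSf using Set.Finite.induction_on with
  | empty =>
    classical
    let g : ℂ → ℂ := fun z => if h : ∃ v ∈ V(G), D.point v = z then L h.choose else 0
    have hg : ∀ v ∈ V(G), g (D.point v) = L v := by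
      intro v hv
      have h : ∃ w ∈ V(G), D.point w = D.point v := ⟨v, hv, rfl⟩
      simp only [g, dif_pos h]
      rw [D.point_injOn h.choose_spec.1 hv h.choose_spec.2]
    refine ⟨g, ?_, ?_, hg⟩
    · simpa [supportOn] using (hV.image D.point).continuousOn g
    · rintro z (⟨v, hv, rfl⟩ | h)
      · rw [hg v hv, hL v hv]
      · simp at h
  | @insert e S heS _ ih =>
    obtain ⟨he, hS'⟩ := insert_subset_iff.1 hS
    obtain ⟨g, hg, hge, hgL⟩ := ih hS' (fun e h => hl e (Or.inr h)) (fun e h => hle e (Or.inr h))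
      (fun e h => hst e (Or.inr h)) (fun e h => hs e (Or.inr h)) (fun e h => ht e (Or.inr h))
      (fun e h => hls e (Or.inr h)) (fun e h => hlt e (Or.inr h))
    have hlink := hst e (Or.inl rfl)
    obtain ⟨g', hg', hge', hgg'⟩ := exists_log_insert (isCompact_supportOn hV hE hS').isClosed hS'
      he heS hg hge (hl e (Or.inl rfl)) (hle e (Or.inl rfl))
      (by rw [hls e (Or.inl rfl), hs e (Or.inl rfl), hgL _ hlink.left_mem])
      (by rw [hlt e (Or.inl rfl), ht e (Or.inl rfl), hgL _ hlink.right_mem])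
    exact ⟨g', hg', hge', fun v hv => by rw [hgg' _ (point_mem_supportOn hv), hgL v hv]⟩

/-- By Eilenberg's criterion it suffices to find a logarithm of (z - p)/(z - q). Choose logarithms
at the vertices and lift along each edge: the lift misses the chosen value at the far end by 2πi
times an integer, and a function on the vertices with this coboundary, up to sign, corrects all
errors at once. -/
theorem isPreconnected_compl_supportOn (hV : V(G).Finite) (hE : E(G).Finite) (hS : S ⊆ E(G))
    (hind : G.CoboundaryOnto S) : IsPreconnected (D.supportOn S)ᶜ := by
  classical
  have hK := isCompact_supportOn (D := D) hV hE hS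
  refine isPreconnected_of_forall_pair fun p hp q hq => ⟨connectedComponentIn (D.supportOn S)ᶜ p,
    connectedComponentIn_subset _ _, mem_connectedComponentIn hp, ?_,
    isPreconnected_connectedComponentIn⟩
  suffices HasLogOn (fun z => (z - p) / (z - q)) (D.supportOn S) by
    rw [connectedComponentIn_eq_of_hasLogOn hK hp hq this]
    exact mem_connectedComponentIn hq
  have hne : ∀ p ∈ (D.supportOn S)ᶜ, ∀ z ∈ D.supportOn S, z - p ≠ 0 := fun p hp z hz h =>
    hp (by rwa [← sub_eq_zero.1 h])
  have hq0 : ∀ z ∈ D.supportOn S, (z - p) / (z - q) ≠ 0 := fun z hz =>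
    div_ne_zero (hne p hp z hz) (hne q hq z hz)
  rcases isEmpty_or_nonempty α with hα | hα
  · refine ⟨fun _ => 0, continuousOn_const, ?_⟩
    rintro z (⟨v, -, -⟩ | h)
    · exact hα.elim v
    · obtain ⟨e, he, -⟩ := mem_iUnion₂.1 h
      obtain ⟨x, -⟩ := D.curve_ends e (hS he)
      exact hα.elim x
  have hends : ∀ e, ∃ x y, e ∈ S →
      G.IsLink e x y ∧ D.curve e 0 = D.point x ∧ D.curve e 1 = D.point y := by
    intro e
    by_cases he : e ∈ S
    · obtain ⟨x, y, h⟩ := D.curve_ends e (hS he)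
      exact ⟨x, y, fun _ => h⟩
    · exact ⟨hα.some, hα.some, fun h => absurd h he⟩
  choose s t hst using hends
  let f : ℂ → ℂ := fun z => (z - p) / (z - q)
  let L₀ : α → ℂ := fun v => Complex.log (f (D.point v))
  have hL₀ : ∀ v ∈ V(G), Complex.exp (L₀ v) = f (D.point v) := fun v hv =>
    Complex.exp_log (hq0 _ (point_mem_supportOn hv))
  have hlift : ∀ e, ∃ (l : I → ℂ) (c : ℤ), e ∈ S → Continuous l ∧
      (∀ r, Complex.exp (l r) = f (D.curve e r)) ∧ l 0 = L₀ (s e) ∧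
      l 1 = L₀ (t e) + c * (2 * Real.pi * Complex.I) := by
    intro e
    by_cases he : e ∈ S
    · have hc := D.curve_continuous e (hS he)
      obtain ⟨hlink, h0, h1⟩ := hst e he
      have hn := fun p hp r => hne p hp (D.curve e r) (curve_mem_supportOn he r)
      obtain ⟨l, hl, hl0, hle⟩ := exists_continuous_log_unitInterval
        (f := fun r => (D.curve e r - p) / (D.curve e r - q))
        ((hc.sub continuous_const).div (hc.sub continuous_const) (hn q hq))
        (fun r => div_ne_zero (hn p hp r) (hn q hq r)) 0 (c := L₀ (s e))
        (by rw [hL₀ _ hlink.left_mem, h0])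
      obtain ⟨c, hc⟩ := exists_intCast_eq_of_exp_eq (a := l 1) (b := L₀ (t e))
        (by rw [hle, hL₀ _ hlink.right_mem, h1])
      exact ⟨l, c, fun _ => ⟨hl, hle, hl0, hc⟩⟩
    · exact ⟨fun _ => 0, 0, fun h => absurd h he⟩
  choose l c hl using hlift
  -- The values at the vertices are lowered by m, so the lift along e fits if m (t e) = m (s e) - c
  -- e.
  obtain ⟨m, hm⟩ := hind (fun e => -c e) s t (fun e he => (hst e he).1)
  have hper : ∀ (k : ℤ) (w : ℂ), Complex.exp (w + k * (2 * Real.pi * Complex.I)) =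
      Complex.exp w := fun k w => by
    rw [Complex.exp_add, Complex.exp_int_mul_two_pi_mul_I, mul_one]
  refine hasLogOn_supportOn_of_lifts hV hE hS (s := s) (t := t)
    (L := fun v => L₀ v + (-m v : ℤ) * (2 * Real.pi * Complex.I))
    (l := fun e r => l e r + (-m (s e) : ℤ) * (2 * Real.pi * Complex.I))
    (fun v hv => by rw [hper, hL₀ v hv]) (fun e he => (hl e he).1.add continuous_const)
    (fun e he r => by rw [hper, (hl e he).2.1 r]) (fun e he => (hst e he).1)
    (fun e he => (hst e he).2.1) (fun e he => (hst e he).2.2)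
    (fun e he => by simp only [(hl e he).2.2.1]) (fun e he => ?_)
  simp only [(hl e he).2.2.2, hm e he]
  push_cast
  ring

/-! ### Cycles -/

theorem exists_oriented_curve {v w : α} (h : G.IsLink e v w) :
    ∃ γ : I → ℂ, Continuous γ ∧ γ 0 = D.point v ∧ γ 1 = D.point w ∧ InjOn γ (Ioo 0 1) ∧
      ∀ r ∈ Ioo (0 : I) 1, γ r ∈ D.openEdge e := by
  have he := h.edge_mem
  have hc := D.curve_continuous e he
  obtain ⟨x, y, hxy, h0, h1⟩ := D.curve_ends e he
  rcases h.eq_and_eq_or_eq_and_eq hxy with ⟨rfl, rfl⟩ | ⟨rfl, rfl⟩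
  · exact ⟨D.curve e, hc, h0, h1, D.curve_injOn e he, fun r hr => ⟨r, hr, rfl⟩⟩
  · have hσ : ∀ r ∈ Ioo (0 : I) 1, unitInterval.symm r ∈ Ioo (0 : I) 1 := by
      intro r hr
      exact ⟨by rw [← unitInterval.symm_one]; exact unitInterval.strictAnti_symm hr.2,
        by rw [← unitInterval.symm_zero]; exact unitInterval.strictAnti_symm hr.1⟩
    refine ⟨D.curve e ∘ unitInterval.symm, hc.comp unitInterval.continuous_symm, by simp [h1],
      by simp [h0], fun r hr r' hr' h => ?_, fun r hr => ⟨_, hσ r hr, rfl⟩⟩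
    exact unitInterval.symm_bijective.injective (D.curve_injOn e he (hσ r hr) (hσ r' hr') h)

/-- The drawing of a cycle is a simple closed curve. -/
theorem exists_simpleClosedCurve {n : ℕ} {v : ℕ → α} {f : ℕ → β} (hC : G.IsCycle n v f) :
    ∃ c : ℝ → ℂ, ContinuousOn c (Icc 0 n) ∧ InjOn c (Ico 0 n) ∧ c 0 = c n ∧
      c '' Icc 0 n ⊆ D.supportOn (f '' Iio n) := by
  have hγ : ∀ k, ∃ γ : I → ℂ, k < n → Continuous γ ∧ γ 0 = D.point (v k) ∧
      γ 1 = D.point (v (k + 1)) ∧ InjOn γ (Ioo 0 1) ∧ ∀ r ∈ Ioo (0 : I) 1,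
        γ r ∈ D.openEdge (f k) := by
    intro k
    by_cases hk : k < n
    · obtain ⟨γ, h⟩ := exists_oriented_curve (D := D) (hC.isLink k hk)
      exact ⟨γ, fun _ => h⟩
    · exact ⟨fun _ => 0, fun h => absurd h hk⟩
  choose γ hγ using hγ
  -- The k-th edge is traversed on [k, k + 1]; the value at n is set separately to close the curve.
  let c : ℝ → ℂ := fun x =>
    if x < n then γ ⌊x⌋₊ (projIcc 0 1 zero_le_one (x - ⌊x⌋₊)) else D.point (v 0)
  have hcn : ∀ k < n, c k = D.point (v k) := by
    intro k hk
    have : (k : ℝ) < n := by exact_mod_cast hk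
    simp [c, this, (hγ k hk).2.1]
  have hcn' : ∀ k ≤ n, c k = D.point (v k) := by
    intro k hk
    rcases hk.lt_or_eq with h | rfl
    · exact hcn k h
    · simp [c, hC.closed]
  have hck : ∀ k < n, ∀ x ∈ Icc (k : ℝ) (k + 1 : ℕ),
      c x = γ k (projIcc 0 1 zero_le_one (x - k)) := by
    intro k hk x hx
    rcases hx.2.lt_or_eq with h | h
    · have h1 : ⌊x⌋₊ = k := by
        rw [Nat.floor_eq_iff (le_trans (Nat.cast_nonneg k) hx.1)]
        exact ⟨hx.1, by simpa using h⟩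
      have h2 : x < n := h.trans_le (by exact_mod_cast hk)
      simp only [c, h2, if_true, h1]
    · rw [h, hcn' _ hk, ← (hγ k hk).2.2.1]
      congr 1
      symm
      exact (projIcc_eq_right (zero_lt_one' ℝ)).2 (by push_cast; linarith)
  have hcI : ∀ k < n, ∀ x ∈ Ioo (k : ℝ) (k + 1 : ℕ),
      projIcc (0 : ℝ) 1 zero_le_one (x - k) ∈ Ioo (0 : I) 1 := by
    intro k hk x hx
    have h1 : 0 < x - k := by linarith [hx.1]
    have h2 : x - k < 1 := by have := hx.2; push_cast at this; linarith
    rw [projIcc_of_mem zero_le_one ⟨h1.le, h2.le⟩]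
    exact ⟨h1, h2⟩
  have hcase : ∀ x ∈ Ico (0 : ℝ) n, ∃ k < n, x = k ∨ x ∈ Ioo (k : ℝ) (k + 1 : ℕ) := by
    intro x hx
    refine ⟨⌊x⌋₊, (Nat.floor_lt hx.1).2 hx.2, ?_⟩
    rcases (Nat.floor_le hx.1).eq_or_lt with h | h
    · exact Or.inl h.symm
    · exact Or.inr ⟨h, by push_cast; exact Nat.lt_floor_add_one x⟩
  have hce : ∀ k < n, ∀ x ∈ Ioo (k : ℝ) (k + 1 : ℕ), c x ∈ D.openEdge (f k) := by
    intro k hk x hx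
    rw [hck k hk x (Ioo_subset_Icc_self hx)]
    exact (hγ k hk).2.2.2.2 _ (hcI k hk x hx)
  have hmemV : ∀ k < n, v k ∈ V(G) := fun k hk => (hC.isLink k hk).left_mem
  have hc0 : c 0 = D.point (v 0) := by have := hcn 0 hC.pos; simpa using this
  refine ⟨c, ?_, ?_, ?_, ?_⟩
  · have : ∀ m : ℕ, m ≤ n → ContinuousOn c (Icc 0 m) := by
      intro m
      induction m with
      | zero => intro _; simp
      | succ m ih =>
        intro hm
        rw [← Icc_union_Icc_eq_Icc (b := (m : ℝ)) (Nat.cast_nonneg m) (by simp)]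
        refine (ih (by omega)).union_of_isClosed ?_ isClosed_Icc isClosed_Icc
        refine ContinuousOn.congr (Continuous.continuousOn ?_) (hck m hm)
        exact (hγ m hm).1.comp (continuous_projIcc.comp (by fun_prop))
    exact this n le_rfl
  · intro x hx y hy hxy
    obtain ⟨k, hk, hxk⟩ := hcase x hx
    obtain ⟨j, hj, hyj⟩ := hcase y hy
    rcases hxk with rfl | hxk <;> rcases hyj with rfl | hyj
    · rw [hcn k hk, hcn j hj] at hxy
      rw [hC.vertex_injOn hk hj (D.point_injOn (hmemV k hk) (hmemV j hj) hxy)]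
    · exfalso
      refine notMem_point_of_mem_openEdge (hC.isLink j hj).edge_mem (hce j hj y hyj) ?_
      rw [← hxy, hcn k hk]
      exact ⟨_, hmemV k hk, rfl⟩
    · exfalso
      refine notMem_point_of_mem_openEdge (hC.isLink k hk).edge_mem (hce k hk x hxk) ?_
      rw [hxy, hcn j hj]
      exact ⟨_, hmemV j hj, rfl⟩
    · have hkj : k = j := by
        refine hC.edge_injOn hk hj ?_
        by_contra hne
        exact disjoint_left.1 (D.curve_disjoint _ (hC.isLink k hk).edge_mem _
          (hC.isLink j hj).edge_mem hne) (hce k hk x hxk) (hxy ▸ hce j hj y hyj)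
      subst hkj
      rw [hck k hk x (Ioo_subset_Icc_self hxk), hck k hk y (Ioo_subset_Icc_self hyj)] at hxy
      have h1 := (hγ k hk).2.2.2.1 (hcI k hk x hxk) (hcI k hk y hyj) hxy
      have h2 : ∀ x ∈ Ioo (k : ℝ) (k + 1 : ℕ), x - k ∈ Icc (0 : ℝ) 1 := by
        intro x hx
        have := hx.2
        push_cast at this
        exact ⟨by linarith [hx.1], by linarith⟩
      rw [projIcc_of_mem _ (h2 x hxk), projIcc_of_mem _ (h2 y hyj)] at h1
      have := congrArg Subtype.val h1
      simp only at this
      linarith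
  · rw [hc0]; simp [c]
  · rintro _ ⟨x, hx, rfl⟩
    rcases hx.2.lt_or_eq with h | rfl
    · obtain ⟨k, hk, rfl | hxk⟩ := hcase x ⟨hx.1, h⟩
      · rw [hcn k hk]
        exact point_mem_supportOn (hmemV k hk)
      · exact Or.inr (mem_biUnion ⟨k, hk, rfl⟩ (openEdge_subset_range (hce k hk x hxk)))
    · rw [hcn' n le_rfl, hC.closed]
      exact point_mem_supportOn (hmemV 0 hC.pos)

/-- If the faces are connected by crossing edges outside `S`, then `S` contains no cycle. -/
theorem not_isCycle_of_forall_face_mem (hV : V(G).Finite) (hE : E(G).Finite) (hS : S ⊆ E(G))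
    (hX : ∀ X : Set (Set ℂ),
      (∀ e ∈ E(G) \ S, ∀ F F', D.dual.IsLink e F F' → F ∈ X → F' ∈ X) →
      ∀ F, D.IsFace F → F ∈ X → ∀ F', D.IsFace F' → F' ∈ X)
    {n : ℕ} {v : ℕ → α} {f : ℕ → β} (hC : G.IsCycle n v f) (hf : ∀ k < n, f k ∈ S) : False := by
  obtain ⟨c, hc, hinj, hcl, hcS⟩ := exists_simpleClosedCurve (D := D) hC
  have hfS : f '' Iio n ⊆ S := by
    rintro _ ⟨k, hk, rfl⟩
    exact hf k hk
  have hn : (0 : ℝ) < n := by exact_mod_cast hC.pos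
  refine not_isPreconnected_compl_simpleClosedCurve hn hc hinj hcl ?_
  have hJS : c '' Icc 0 n ⊆ D.supportOn S := hcS.trans (supportOn_mono hfS)
  have hJK : c '' Icc 0 n ⊆ D.support := hJS.trans (supportOn_mono hS)
  have hJo : IsOpen (c '' Icc (0 : ℝ) n)ᶜ :=
    (isCompact_Icc.image_of_continuousOn hc).isClosed.isOpen_compl
  set J := c '' Icc (0 : ℝ) n
  have hFJ : ∀ F, D.IsFace F → F ⊆ Jᶜ := fun F hF => hF.subset.trans (compl_subset_compl.2 hJK)
  -- Every component of the complement of J contains a face, because faces are dense. Crossing an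
  -- edge outside S does not leave the component, since the open edge is disjoint from J. So each
  -- component contains all faces, and there is only one.
  have key : ∀ p ∈ Jᶜ, ∀ F, D.IsFace F → F ⊆ connectedComponentIn Jᶜ p := by
    intro p hp
    obtain ⟨F₀, hF₀, z, hz, hzp⟩ := exists_isFace_inter_nonempty (D := D) hV hE
      (hJo.connectedComponentIn (x := p)) ⟨p, mem_connectedComponentIn hp⟩
    have hF₀p : F₀ ⊆ connectedComponentIn Jᶜ p := by
      rw [connectedComponentIn_eq hzp]
      exact hF₀.isPreconnected.subset_connectedComponentIn hz (hFJ _ hF₀)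
    refine fun F hF => hX {F | F ⊆ connectedComponentIn Jᶜ p} ?_ F₀ hF₀ hF₀p F hF
    intro e he H H' hHH' hH
    have hHe := isBoundaryEdge_left_of_isLink hHH'
    have hHe' := isBoundaryEdge_right_of_isLink hHH'
    obtain ⟨x, hx⟩ := openEdge_nonempty (D := D) (e := e)
    have hxJ : x ∈ Jᶜ := fun h => disjoint_left.1
      (disjoint_openEdge_supportOn he.1 hS he.2) hx (hJS h)
    -- A face together with a point of its closure is connected, so the point x of e links the faces
    -- on its two sides.
    have hpre : ∀ H, D.IsFace H → D.IsBoundaryEdge e H → insert x H ⊆ connectedComponentIn Jᶜ x :=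
      fun H hH hHe => (hH.isPreconnected.subset_closure (subset_insert x H)
        (insert_subset (hHe.openEdge_subset_closure hx) subset_closure)).subset_connectedComponentIn
        (mem_insert x H) (insert_subset hxJ (hFJ H hH))
    obtain ⟨y, hy⟩ := hHH'.2.1.nonempty
    have h1 : connectedComponentIn Jᶜ p = connectedComponentIn Jᶜ x := by
      rw [connectedComponentIn_eq (hH hy),
        connectedComponentIn_eq (hpre H hHH'.2.1 hHe (Or.inr hy))]
    rw [mem_ofPred_eq, h1]
    exact (subset_insert x H').trans (hpre H' hHH'.2.2.1 hHe')
  refine isPreconnected_of_forall_pair fun p hp q hq => ⟨connectedComponentIn Jᶜ p,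
    connectedComponentIn_subset _ _, mem_connectedComponentIn hp, ?_,
    isPreconnected_connectedComponentIn⟩
  obtain ⟨F₀, hF₀, z, hz, hzp⟩ := exists_isFace_inter_nonempty (D := D) hV hE isOpen_univ
    univ_nonempty
  rw [connectedComponentIn_eq (key p hp F₀ hF₀ hz), ← connectedComponentIn_eq (key q hq F₀ hF₀ hz)]
  exact mem_connectedComponentIn hq

end PlaneDrawing

end Graph

end

/-! ### Acyclic edge sets, search trees and fundamental cuts in abstract graphs -/

noncomputable section

namespace Graph

open Set

variable {α β : Type*} {G : Graph α β} {S : Set β} {e : β} {x y z : α}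

/-! ### Acyclic sets of edges -/

/-- `x` and `y` are joined by an edge in `S`. -/
def AdjOn (G : Graph α β) (S : Set β) (x y : α) : Prop := ∃ e ∈ S, G.IsLink e x y

/-- `x` and `y` are joined by a walk with edges in `S`. -/
def ReachableOn (G : Graph α β) (S : Set β) : α → α → Prop := Relation.ReflTransGen (G.AdjOn S)

theorem ReachableOn.symm (h : G.ReachableOn S x y) : G.ReachableOn S y x := by
  have : Std.Symm (G.AdjOn S) := ⟨fun _ _ ⟨e, he, h⟩ => ⟨e, he, h.symm⟩⟩
  exact Std.Symm.symm (r := Relation.ReflTransGen (G.AdjOn S)) _ _ h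

/-- No cycle of `G` has all its edges in `S`. -/
def AcyclicOn (G : Graph α β) (S : Set β) : Prop :=
  ∀ n v f, G.IsCycle n v f → ¬ ∀ k < n, f k ∈ S

theorem AcyclicOn.mono {S' : Set β} (h : G.AcyclicOn S) (h' : S' ⊆ S) : G.AcyclicOn S' :=
  fun n v f hC hf => h n v f hC fun k hk => h' (hf k hk)

theorem ReachableOn.exists_path [Nonempty β] (h : G.ReachableOn S x y) :
    ∃ (n : ℕ) (v : ℕ → α) (f : ℕ → β), v 0 = x ∧ v n = y ∧ InjOn v (Iic n) ∧
      ∀ k < n, f k ∈ S ∧ G.IsLink (f k) (v k) (v (k + 1)) := by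
  induction h with
  | refl =>
    refine ⟨0, fun _ => x, fun _ => Classical.arbitrary β, rfl, rfl, fun i hi j hj _ => ?_,
      fun k hk => absurd hk k.not_lt_zero⟩
    rw [mem_Iic, Nat.le_zero] at hi hj
    rw [hi, hj]
  | @tail b c _ hbc ih =>
    obtain ⟨n, v, f, h0, hn, hinj, hlink⟩ := ih
    obtain ⟨e, he, hl⟩ := hbc
    -- If the new vertex is already on the path, the path is cut off there instead of being
    -- extended.
    by_cases hc : ∃ j ≤ n, v j = c
    · obtain ⟨j, hj, hvj⟩ := hc
      exact ⟨j, v, f, h0, hvj, hinj.mono (Iic_subset_Iic.2 hj),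
        fun k hk => hlink k (hk.trans_le hj)⟩
    · push Not at hc
      refine ⟨n + 1, fun k => if k ≤ n then v k else c, fun k => if k < n then f k else e,
        by simp [h0], by simp, ?_, ?_⟩
      · intro i hi j hj hij
        simp only [mem_Iic] at hi hj
        simp only at hij
        split_ifs at hij with h1 h2 h2
        · exact hinj h1 h2 hij
        · exact absurd hij (hc i h1)
        · exact absurd hij.symm (hc j h2)
        · omega
      · intro k hk
        rcases (Nat.lt_succ_iff.1 hk).lt_or_eq with h | rfl
        · simpa [h, h.le, Nat.succ_le_iff.2 h] using hlink k h
        · simpa [hn] using ⟨he, hl⟩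

/-- An edge closes a cycle with a walk between its ends. -/
theorem AcyclicOn.not_reachableOn (h : G.AcyclicOn S) (he : e ∈ S) (hl : G.IsLink e x y) :
    ¬ G.ReachableOn (S \ {e}) y x := by
  intro hr
  have : Nonempty β := ⟨e⟩
  obtain ⟨n, v, f, h0, hn, hinj, hlink⟩ := hr.exists_path
  refine h (n + 1) (fun k => if k ≤ n then v k else y) (fun k => if k < n then f k else e)
    ⟨Nat.succ_pos n, ?_, by simp [h0], ?_, ?_⟩ ?_
  · intro k hk
    rcases (Nat.lt_succ_iff.1 hk).lt_or_eq with h | rfl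
    · simpa [h, h.le, Nat.succ_le_iff.2 h] using (hlink k h).2
    · simpa [hn] using hl
  · intro i hi j hj hij
    have hi' : i ≤ n := Nat.lt_succ_iff.1 hi
    have hj' : j ≤ n := Nat.lt_succ_iff.1 hj
    simp only [hi', hj', if_true] at hij
    exact hinj hi' hj' hij
  · intro i hi j hj hij
    have hi' : i ≤ n := Nat.lt_succ_iff.1 hi
    have hj' : j ≤ n := Nat.lt_succ_iff.1 hj
    simp only at hij
    split_ifs at hij with h1 h2 h2
    · have l1 := (hlink i h1).2
      have l2 := (hlink j h2).2
      rw [hij] at l1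
      -- A repeated edge traversed in opposite directions would require i = j + 1 and j = i + 1.
      rcases l1.eq_and_eq_or_eq_and_eq l2 with ⟨h3, -⟩ | ⟨h3, h4⟩
      · exact hinj hi' hj' h3
      · have h5 := hinj hi' (show j + 1 ∈ Iic n from h2) h3
        have h6 := hinj (show i + 1 ∈ Iic n from h1) hj' h4
        omega
    · exact absurd hij (hlink i h1).1.2
    · exact absurd hij.symm (hlink j h2).1.2
    · omega
  · intro k hk
    split_ifs with h1
    · exact (hlink k h1).1.1
    · exact he

theorem coboundaryOnto_empty : G.CoboundaryOnto ∅ := fun _ _ _ _ => ⟨fun _ => 0, by simp⟩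

/-- Adding an edge between two parts of the graph. -/
theorem CoboundaryOnto.insert (h : G.CoboundaryOnto S) {A : Set α}
    (hA : ∀ e ∈ S, ∀ u w, G.IsLink e u w → u ∈ A → w ∈ A) (hl : G.IsLink e x y) (hx : x ∉ A)
    (hy : y ∈ A) : G.CoboundaryOnto (insert e S) := by
  classical
  intro c s t hst
  obtain ⟨m, hm⟩ := h c s t fun e he => hst e (Or.inr he)
  -- No edge of S leaves A, so shifting m by a constant on A keeps all equations on S; the constant
  -- is then chosen to satisfy the one for e.
  have key : ∀ k : ℤ, ∀ e' ∈ S, m (t e') + (if t e' ∈ A then k else 0) =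
      m (s e') + (if s e' ∈ A then k else 0) + c e' := by
    intro k e' he'
    have h1 := hst e' (Or.inr he')
    have h2 : s e' ∈ A ↔ t e' ∈ A := ⟨hA e' he' _ _ h1, hA e' he' _ _ h1.symm⟩
    rw [hm e' he']
    simp only [h2]
    ring
  rcases hl.eq_and_eq_or_eq_and_eq (hst e (Or.inl rfl)) with ⟨h1, h2⟩ | ⟨h1, h2⟩
  · refine ⟨fun z => m z + (if z ∈ A then m x + c e - m y else 0), ?_⟩
    rintro e' (rfl | he')
    · rw [← h1, ← h2]
      simp only [hx, hy, if_true, if_false]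
      ring
    · exact key _ e' he'
  · refine ⟨fun z => m z + (if z ∈ A then m x - c e - m y else 0), ?_⟩
    rintro e' (rfl | he')
    · rw [← h1, ← h2]
      simp only [hx, hy, if_true, if_false]
      ring
    · exact key _ e' he'

theorem mem_of_adjOn_reachableOn {a b : α} (he : e ∈ S) (hl : G.IsLink e a b)
    (h : a ∈ {z | G.ReachableOn S x z}) : b ∈ {z | G.ReachableOn S x z} :=
  Relation.ReflTransGen.tail h ⟨e, he, hl⟩

/-- Induction on S: by acyclicity the new edge joins different components of the old edges. -/
theorem AcyclicOn.coboundaryOnto (hS : S.Finite) (hSE : S ⊆ E(G)) (h : G.AcyclicOn S) :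
    G.CoboundaryOnto S := by
  induction S, hS using Set.Finite.induction_on with
  | empty => exact coboundaryOnto_empty
  | @insert e S heS _ ih =>
    obtain ⟨he, hSE'⟩ := insert_subset_iff.1 hSE
    obtain ⟨x, y, hl⟩ := G.exists_isLink_of_mem_edgeSet he
    have hr := h.not_reachableOn (Or.inl rfl) hl
    rw [insert_sdiff_self_of_notMem heS] at hr
    exact (ih hSE' (h.mono (subset_insert _ _))).insert (A := {z | G.ReachableOn S y z})
      (fun e he u w hl hu => mem_of_adjOn_reachableOn he hl hu) hl hr Relation.ReflTransGen.refl

theorem AcyclicOn.not_reachableOn_trans (h : G.AcyclicOn S) (he : e ∈ S) (hl : G.IsLink e x y)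
    {a : α} (ha : G.ReachableOn (S \ {e}) x a) : ¬ G.ReachableOn (S \ {e}) y a := fun h' =>
  h.not_reachableOn he hl (Relation.ReflTransGen.trans h' ha.symm)

/-! ### Breadth first search -/

/-- There is a walk of length `n` from the root to `x`. -/
inductive HasWalk (G : Graph α β) (r : α) : ℕ → α → Prop
  | nil : HasWalk G r 0 r
  | snoc {n : ℕ} {e : β} {x y : α} (h : HasWalk G r n x) (hl : G.IsLink e x y) :
      HasWalk G r (n + 1) y

/-- The length of a shortest walk from the root. -/
def level (G : Graph α β) (r x : α) : ℕ := sInf {n | G.HasWalk r n x}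

variable {r : α} {n : ℕ}

theorem level_le (h : G.HasWalk r n x) : G.level r x ≤ n := Nat.sInf_le h

theorem hasWalk_level (h : ∃ n, G.HasWalk r n x) : G.HasWalk r (G.level r x) x := Nat.sInf_mem h

theorem level_root : G.level r r = 0 := Nat.le_zero.1 (level_le HasWalk.nil)

theorem hasWalk_of_isLink {v : ℕ → α} {f : ℕ → β} (h0 : v 0 = r)
    (hl : ∀ k < n, G.IsLink (f k) (v k) (v (k + 1))) : G.HasWalk r n (v n) := by
  induction n with
  | zero => rw [h0]; exact HasWalk.nil
  | succ n ih => exact (ih fun k hk => hl k (hk.trans n.lt_succ_self)).snoc (hl n n.lt_succ_self)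

theorem exists_isLink_level (h : ∃ n, G.HasWalk r n x) (hx : x ≠ r) :
    ∃ e y, G.IsLink e y x ∧ (∃ n, G.HasWalk r n y) ∧ G.level r y + 1 = G.level r x := by
  have hw := hasWalk_level h
  generalize hn : G.level r x = n at hw
  cases hw with
  | nil => exact absurd rfl hx
  | @snoc m e y _ h' hl =>
    refine ⟨e, y, hl, ⟨_, h'⟩, le_antisymm (Nat.succ_le_succ (level_le h')) ?_⟩
    rw [← hn]
    exact level_le ((hasWalk_level ⟨_, h'⟩).snoc hl)

/-- The levels along the walk are recorded because they show that its vertices are distinct. -/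
theorem exists_geodesic [Nonempty β] (h : ∃ n, G.HasWalk r n x) :
    ∃ (v : ℕ → α) (f : ℕ → β), v 0 = r ∧ v (G.level r x) = x ∧
      (∀ k ≤ G.level r x, G.level r (v k) = k) ∧
      ∀ k < G.level r x, G.IsLink (f k) (v k) (v (k + 1)) := by
  generalize hn : G.level r x = n
  induction n generalizing x with
  | zero =>
    have hw := hasWalk_level h
    rw [hn] at hw
    cases hw
    refine ⟨fun _ => r, fun _ => Classical.arbitrary β, rfl, rfl, fun k hk => ?_,
      fun k hk => absurd hk k.not_lt_zero⟩
    rw [Nat.le_zero.1 hk, level_root]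
  | succ n ih =>
    have hx : x ≠ r := by
      rintro rfl
      rw [level_root] at hn
      exact absurd hn.symm n.succ_ne_zero
    obtain ⟨e, y, hl, hy, hyx⟩ := exists_isLink_level h hx
    obtain ⟨v, f, h0, hvn, hlev, hlink⟩ := ih hy (by omega)
    refine ⟨fun k => if k ≤ n then v k else x, fun k => if k < n then f k else e, by simp [h0],
      by simp, fun k hk => ?_, fun k hk => ?_⟩
    · dsimp only
      rcases hk.lt_or_eq with h | rfl
      · rw [if_pos (Nat.lt_succ_iff.1 h), hlev k (Nat.lt_succ_iff.1 h)]
      · rw [if_neg (by omega), hn]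
    · rcases (Nat.lt_succ_iff.1 hk).lt_or_eq with h | rfl
      · simpa [h, h.le, Nat.succ_le_iff.2 h] using hlink k h
      · simpa [hvn] using hl

/-- A breadth first search tree in a connected graph with root `r`, given by the parent `par x` of
a vertex `x ≠ r` and the edge `up x` which joins it to `x`. -/
structure IsSearchTree (G : Graph α β) (r : α) (up : α → β) (par : α → α) : Prop where
  isLink : ∀ x ∈ V(G), x ≠ r → G.IsLink (up x) (par x) x
  par_root : par r = r
  level_par : ∀ x ∈ V(G), x ≠ r → G.level r (par x) + 1 = G.level r x

theorem exists_isSearchTree [Nonempty β] (h : ∀ x ∈ V(G), ∃ n, G.HasWalk r n x) :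
    ∃ up par, G.IsSearchTree r up par := by
  classical
  have key : ∀ x, ∃ e y, x ∈ V(G) → x ≠ r → G.IsLink e y x ∧ G.level r y + 1 = G.level r x := by
    intro x
    by_cases hx : x ∈ V(G) ∧ x ≠ r
    · obtain ⟨e, y, hl, -, hy⟩ := exists_isLink_level (h x hx.1) hx.2
      exact ⟨e, y, fun _ _ => ⟨hl, hy⟩⟩
    · exact ⟨Classical.arbitrary β, x, fun h1 h2 => absurd ⟨h1, h2⟩ hx⟩
  choose up par hup using key
  refine ⟨up, fun x => if x = r then r else par x, fun x hx hr => ?_, by simp, fun x hx hr => ?_⟩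
  · rw [if_neg hr]; exact (hup x hx hr).1
  · rw [if_neg hr]; exact (hup x hx hr).2

theorem level_eq_zero (h : ∃ n, G.HasWalk r n x) (h0 : G.level r x = 0) : x = r := by
  have hw := hasWalk_level h
  rw [h0] at hw
  cases hw
  rfl

/-- The descendants of `x`. -/
def descendants (par : α → α) (x : α) : Set α := {y | ∃ k, par^[k] y = x}

theorem self_mem_descendants {par : α → α} : x ∈ descendants par x := ⟨0, rfl⟩

theorem mem_descendants_iff {par : α → α} :
    y ∈ descendants par x ↔ y = x ∨ par y ∈ descendants par x := by
  constructor
  · rintro ⟨k, hk⟩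
    cases k with
    | zero => exact Or.inl hk
    | succ k => exact Or.inr ⟨k, hk⟩
  · rintro (rfl | ⟨k, hk⟩)
    · exact self_mem_descendants
    · exact ⟨k + 1, hk⟩

/-- The ancestors of `y` other than the root. -/
def ancestors (r : α) (par : α → α) (y : α) : Set α := {x | x ≠ r ∧ y ∈ descendants par x}

/-- The edges of a search tree. -/
def searchTreeEdges (G : Graph α β) (r : α) (up : α → β) : Set β := up '' (V(G) \ {r})

namespace IsSearchTree

variable {up : α → β} {par : α → α}

theorem root_notMem_descendants (hT : G.IsSearchTree r up par) (hx : x ≠ r) :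
    r ∉ descendants par x := by
  rintro ⟨k, hk⟩
  rw [Function.iterate_fixed hT.par_root] at hk
  exact hx hk.symm

/-- Only `up x` connects the subtree below x to the rest of the tree: for w ≠ x, either both or
neither of w and `par w` are descendants of x. -/
theorem mem_descendants_of_isLink (hT : G.IsSearchTree r up par)
    (he : e ∈ G.searchTreeEdges r up) (hne : e ≠ up x) (hl : G.IsLink e y z)
    (hy : y ∈ descendants par x) : z ∈ descendants par x := by
  obtain ⟨w, ⟨hw, hwr⟩, rfl⟩ := he
  have hwx : w ≠ x := fun h => hne (congrArg up h)
  rcases (hT.isLink w hw hwr).eq_and_eq_or_eq_and_eq hl with ⟨rfl, rfl⟩ | ⟨rfl, rfl⟩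
  · exact mem_descendants_iff.2 (Or.inr hy)
  · exact (mem_descendants_iff.1 hy).resolve_left hwx

/-- A step to the parent lowers the level by one and loses at most one ancestor. This is how
distances enter the bound. -/
theorem encard_ancestors_le (hT : G.IsSearchTree r up par)
    (h : ∀ x ∈ V(G), ∃ n, G.HasWalk r n x) (hx : x ∈ V(G)) :
    (ancestors r par x).encard ≤ G.level r x := by
  generalize hn : G.level r x = n
  induction n generalizing x with
  | zero =>
    obtain rfl := level_eq_zero (h x hx) hn
    have : ancestors x par x = ∅ :=
      eq_empty_of_forall_notMem fun y hy => hT.root_notMem_descendants hy.1 hy.2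
    simp [this]
  | succ n ih =>
    have hxr : x ≠ r := by
      rintro rfl
      rw [level_root] at hn
      exact absurd hn.symm n.succ_ne_zero
    have hsub : ancestors r par x ⊆ insert x (ancestors r par (par x)) := by
      rintro y ⟨hy, hxy⟩
      rcases mem_descendants_iff.1 hxy with h | h
      · exact Or.inl h.symm
      · exact Or.inr ⟨hy, h⟩
    have hlev := hT.level_par x hx hxr
    calc (ancestors r par x).encard ≤ (insert x (ancestors r par (par x))).encard :=
          encard_le_encard hsub
      _ ≤ (ancestors r par (par x)).encard + 1 := encard_insert_le _ _
      _ ≤ n + 1 := by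
          gcongr
          exact ih (hT.isLink x hx hxr).left_mem (by omega)
      _ = ((n + 1 : ℕ) : ℕ∞) := by push_cast; rfl

theorem mem_iff_root_mem (hT : G.IsSearchTree r up par)
    (h : ∀ x ∈ V(G), ∃ n, G.HasWalk r n x) {X : Set α}
    (hX : ∀ e ∈ G.searchTreeEdges r up, ∀ y z, G.IsLink e y z → y ∈ X → z ∈ X) (hx : x ∈ V(G)) :
    x ∈ X ↔ r ∈ X := by
  generalize hn : G.level r x = n
  induction n generalizing x with
  | zero => rw [level_eq_zero (h x hx) hn]
  | succ n ih =>
    have hxr : x ≠ r := by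
      rintro rfl
      rw [level_root] at hn
      exact absurd hn.symm n.succ_ne_zero
    have hl := hT.isLink x hx hxr
    have he : up x ∈ G.searchTreeEdges r up := ⟨x, ⟨hx, hxr⟩, rfl⟩
    rw [← ih hl.left_mem (by have := hT.level_par x hx hxr; omega)]
    exact ⟨hX _ he _ _ hl.symm, hX _ he _ _ hl⟩

end IsSearchTree

/-! ### The congestion of spanning trees -/

theorem reachable_restrict_iff {S : Set β} (hx : x ∈ V(G)) :
    (G.restrict S).Reachable x y ↔ G.ReachableOn S x y := by
  simp only [Reachable, vertexSet_restrict, hx, true_and, ReachableOn]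
  rfl

theorem component_restrict_deleteEdges (hx : x ∈ V(G)) :
    ((G.restrict S).deleteEdges {e}).component x = {y | G.ReachableOn (S \ {e}) x y} := by
  have : ((G.restrict S).deleteEdges {e}).Adj = G.AdjOn (S \ {e}) := by
    funext a b
    simp only [Adj, AdjOn, deleteEdges_isLink, restrict_isLink, mem_singleton_iff, mem_sdiff,
      eq_iff_iff]
    exact exists_congr fun _ => by tauto
  ext y
  simp [component, Reachable, hx, ReachableOn, this]

theorem isSpanningTree_restrict (hV : V(G).Nonempty)
    (hc : ∀ x ∈ V(G), ∀ y ∈ V(G), G.ReachableOn S x y) (ha : G.AcyclicOn S) :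
    (G.restrict S).IsSpanningTree G := by
  refine ⟨⟨restrict_le, rfl⟩, ⟨hV,
    fun x hx y hy => (reachable_restrict_iff (G := G) hx).2 (hc x hx y hy)⟩,
    fun n v f hC => ha n v f ⟨hC.pos, fun k hk => (hC.isLink k hk).2, hC.closed, hC.vertex_injOn,
      hC.edge_injOn⟩ fun k hk => (hC.isLink k hk).1⟩

/-- An edge other than `e` across the fundamental cut of `e` lies outside the tree, and can be
exchanged for `e`. -/
theorem coboundaryOnto_exchange (hSf : S.Finite) (hSE : S ⊆ E(G)) (ha : G.AcyclicOn S) {g : β}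
    (he : e ∈ S) (hg : g ∈ G.congestionSet (G.restrict S) e) (hge : g ≠ e) :
    g ∈ E(G) \ S ∧ G.CoboundaryOnto (insert g (S \ {e})) := by
  obtain ⟨x, y, hl, a, hxa, b, hyb, hab⟩ := hg
  have hl' : G.IsLink e x y := hl.2
  rw [component_restrict_deleteEdges hl'.left_mem] at hxa
  rw [component_restrict_deleteEdges hl'.right_mem] at hyb
  have hya : ¬ G.ReachableOn (S \ {e}) y a := ha.not_reachableOn_trans he hl' hxa
  refine ⟨⟨hab.edge_mem, fun hgS => hya ?_⟩, ?_⟩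
  · exact Relation.ReflTransGen.tail hyb ⟨g, ⟨hgS, hge⟩, hab.symm⟩
  · exact ((ha.mono sdiff_subset).coboundaryOnto (hSf.subset sdiff_subset)
      (sdiff_subset.trans hSE)).insert (A := {z | G.ReachableOn (S \ {e}) y z})
      (fun e he u w hl hu => mem_of_adjOn_reachableOn he hl hu) hab hya hyb

end Graph

end

/-! ### The spanning tree complementary to a dual search tree, and its congestion -/

noncomputable section

namespace Graph

namespace PlaneDrawing

open Set Filter Topology PlaneTopology

variable {α β : Type*} {G : Graph α β} {D : PlaneDrawing G}
variable {e : β} {S : Set β} {F F' O : Set ℂ}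

theorem exists_isExteriorFace (hV : V(G).Finite) (hE : E(G).Finite) : ∃ O, D.IsExteriorFace O := by
  obtain ⟨p, hp, hb⟩ := exists_not_isBounded_connectedComponentIn (isCompact_support (D := D) hV hE)
  exact ⟨_, isFace_connectedComponentIn hp, hb⟩

theorem IsExteriorFace.eq (hV : V(G).Finite) (hE : E(G).Finite) (hF : D.IsExteriorFace F)
    (hF' : D.IsExteriorFace F') : F = F' := by
  obtain ⟨⟨p, -, rfl⟩, hb⟩ := hF
  obtain ⟨⟨q, -, rfl⟩, hb'⟩ := hF'
  exact eq_of_not_isBounded (isCompact_support hV hE) hb hb'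

/-- Connectedness of the dual graph: the vertices alone do not separate the plane, so crossing edges
leads from O to every face. -/
theorem exists_hasWalk_dual (hV : V(G).Finite) (hE : E(G).Finite) (hO : D.IsFace O) :
    ∀ F ∈ V(D.dual), ∃ n, D.dual.HasWalk O n F := fun _ hF =>
  forall_face_mem_of_isPreconnected hV hE (empty_subset _)
    (isPreconnected_compl_supportOn hV hE (empty_subset _) coboundaryOnto_empty)
    (X := {F | ∃ n, D.dual.HasWalk O n F})
    (fun _ _ _ _ hl ⟨n, hn⟩ => ⟨n + 1, hn.snoc hl⟩) hO ⟨0, HasWalk.nil⟩ hF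

theorem level_le_absoluteIndex (hV : V(G).Finite) (hE : E(G).Finite) (hO : D.IsExteriorFace O) :
    (D.dual.level O F : ℕ∞) ≤ D.absoluteIndex F := by
  rw [absoluteIndex]
  split_ifs with h
  · rw [h.eq hV hE hO, level_root]
    rfl
  · refine le_iInf₂ fun e _ => le_iInf₂ fun O' hO' => le_iInf₂ fun n hn => ?_
    obtain ⟨v, f, -, h0, hvn, -, -, hl⟩ := hn
    rw [← hvn]
    exact_mod_cast level_le (hasWalk_of_isLink (h0.trans (hO'.eq hV hE hO)) hl)

/-- A shortest walk from O to another face is a path. Its second face differs from O and is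
therefore bounded, so its first edge is an outer edge. -/
theorem absoluteIndex_le_level (hV : V(G).Finite) (hE : E(G).Finite) [Nonempty β]
    (hO : D.IsExteriorFace O) (hF : D.IsFace F) :
    D.absoluteIndex F ≤ (D.dual.level O F : ℕ∞) := by
  rw [absoluteIndex]
  split_ifs with h
  · exact zero_le
  · have hwalk := exists_hasWalk_dual hV hE hO.1 F hF
    obtain ⟨v, f, h0, hvn, hlev, hl⟩ := exists_geodesic hwalk
    have hpos : 0 < D.dual.level O F := by
      rw [Nat.pos_iff_ne_zero]
      intro h0
      exact h (level_eq_zero hwalk h0 ▸ hO)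
    have hl0 := hl 0 hpos
    rw [h0] at hl0
    have hv1 : v 1 ≠ O := by
      intro h1
      have := hlev 1 hpos
      rw [h1, level_root] at this
      exact absurd this zero_ne_one
    have hb : Bornology.IsBounded (v 1) := by
      by_contra hb
      exact hv1 (IsExteriorFace.eq hV hE ⟨hl0.right_mem, hb⟩ hO)
    refine iInf₂_le_of_le (f 0) ⟨⟨O, hO, isBoundaryEdge_left_of_isLink hl0⟩, v 1,
      ⟨hl0.right_mem, hb⟩, isBoundaryEdge_right_of_isLink hl0⟩ ?_
    refine iInf₂_le_of_le O hO (iInf₂_le_of_le (D.dual.level O F)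
      ⟨v, f, hpos, h0, hvn, rfl, fun i hi j hj hij => ?_, hl⟩ le_rfl)
    rw [← hlev i hi, ← hlev j hj, hij]

theorem AreAdjacentFaces.exists_isLink (hV : V(G).Finite) (hE : E(G).Finite)
    (h : D.AreAdjacentFaces F F') : ∃ e, D.dual.IsLink e F F' :=
  let ⟨hF, hF', hne, e, he, he'⟩ := h
  ⟨e, isLink_of_isBoundaryEdge hV hE hF hF' he he' hne⟩

theorem areAdjacentFaces_of_isLink (h : D.dual.IsLink e F F') (hne : F ≠ F') :
    D.AreAdjacentFaces F F' :=
  ⟨h.2.1, h.2.2.1, hne, e, isBoundaryEdge_left_of_isLink h, isBoundaryEdge_right_of_isLink h⟩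

/-- Adjacent faces are linked by an edge, an edge determines the pair, and there are finitely many
edges. -/
theorem maxIndexSum_lt_top (hV : V(G).Finite) (hE : E(G).Finite) : D.maxIndexSum < ⊤ := by
  obtain ⟨O, hO⟩ := exists_isExteriorFace (D := D) hV hE
  have hB : ∀ e, ∃ N : ℕ, ∀ F F', D.dual.IsLink e F F' →
      D.absoluteIndex F + D.absoluteIndex F' ≤ N := by
    intro e
    have : Nonempty β := ⟨e⟩
    by_cases he : e ∈ E(G)
    · obtain ⟨H, H', hH⟩ := exists_dual_isLink (D := D) hV hE he
      refine ⟨D.dual.level O H + D.dual.level O H', fun F F' hF => ?_⟩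
      have h1 := absoluteIndex_le_level hV hE hO hH.2.1
      have h2 := absoluteIndex_le_level hV hE hO hH.2.2.1
      push_cast
      rcases hF.eq_and_eq_or_eq_and_eq hH with ⟨rfl, rfl⟩ | ⟨rfl, rfl⟩
      · exact add_le_add h1 h2
      · rw [add_comm]
        exact add_le_add h1 h2
    · exact ⟨0, fun F F' h => absurd h.1 he⟩
  choose N hN using hB
  obtain ⟨M, hM⟩ := (hE.image N).bddAbove
  refine lt_of_le_of_lt (b := (M : ℕ∞)) ?_ (ENat.natCast_lt_top M)
  refine iSup₂_le fun F F' => iSup_le fun h => ?_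
  obtain ⟨e, he⟩ := h.exists_isLink hV hE
  refine (hN e F F' he).trans ?_
  exact_mod_cast hM ⟨e, he.1, rfl⟩

theorem absoluteIndex_add_le_maxIndexSum (h : D.AreAdjacentFaces F F') :
    D.absoluteIndex F + D.absoluteIndex F' ≤ D.maxIndexSum :=
  le_iSup₂_of_le F F' (le_iSup_of_le h le_rfl)

section SearchTree

variable {up : Set ℂ → β} {par : Set ℂ → Set ℂ}

/-- The dual tree links all faces without crossing an edge of the complementary set, whereas a cycle
in that set would separate the plane. -/
theorem acyclicOn_of_isSearchTree (hV : V(G).Finite) (hE : E(G).Finite) (hO : D.IsFace O)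
    (hT : D.dual.IsSearchTree O up par) :
    G.AcyclicOn (E(G) \ D.dual.searchTreeEdges O up) := by
  intro n v f hC hf
  refine not_isCycle_of_forall_face_mem (D := D) hV hE sdiff_subset (fun X hX F hF hFX F' hF' => ?_)
    hC hf
  have hX' : ∀ e ∈ D.dual.searchTreeEdges O up, ∀ F F', D.dual.IsLink e F F' → F ∈ X → F' ∈ X :=
    fun e he F F' hl => hX e ⟨hl.1, fun h => h.2 he⟩ F F' hl
  have hw := exists_hasWalk_dual hV hE hO
  exact (hT.mem_iff_root_mem hw hX' hF').2 ((hT.mem_iff_root_mem hw hX' hF).1 hFX)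

/-- If `S` does not separate the plane and `up F` is not in `S`, then some edge outside the search
tree and outside `S` joins a descendant of `F` to another face. -/
theorem exists_isLink_descendants (hV : V(G).Finite) (hE : E(G).Finite) (hO : D.IsFace O)
    (hT : D.dual.IsSearchTree O up par) (hS : S ⊆ E(G)) (hc : G.CoboundaryOnto S)
    (hF : D.IsFace F) (hFO : F ≠ O) :
    ∃ e ∈ E(G) \ S, (e = up F ∨ e ∉ D.dual.searchTreeEdges O up) ∧ ∃ H H', D.dual.IsLink e H H' ∧
      H ∈ descendants par F ∧ H' ∉ descendants par F := by
  by_contra! h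
  -- Otherwise no crossing of an edge outside S leads out of the descendants of F. As S does not
  -- separate the plane, O would be one of them.
  refine hT.root_notMem_descendants hFO (forall_face_mem_of_isPreconnected hV hE hS
    (isPreconnected_compl_supportOn hV hE hS hc) (X := descendants par F) ?_ hF
    self_mem_descendants hO)
  intro e he H H' hl hH
  by_cases he' : e = up F ∨ e ∉ D.dual.searchTreeEdges O up
  · exact h e he he' H H' hl hH
  · push Not at he'
    exact hT.mem_descendants_of_isLink he'.2 he'.1 hl hH

/-- Otherwise some edge `up F` leaves the component of x. Adding it to the complementary set S still
leaves the plane unseparated. But then only dual tree edges other than `up F` remain to be crossed,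
and these do not lead from F to O. -/
theorem reachableOn_of_isSearchTree (hV : V(G).Finite) (hE : E(G).Finite) (hG : G.IsConnected)
    (hO : D.IsFace O) (hT : D.dual.IsSearchTree O up par) {x y : α} (hx : x ∈ V(G))
    (hy : y ∈ V(G)) : G.ReachableOn (E(G) \ D.dual.searchTreeEdges O up) x y := by
  by_contra hxy
  set S := E(G) \ D.dual.searchTreeEdges O up with hS
  obtain ⟨e, u, w, hl, hu, hw⟩ : ∃ e u w, G.IsLink e u w ∧ G.ReachableOn S x u ∧
      ¬ G.ReachableOn S x w := by
    by_contra! h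
    refine hxy ?_
    have := (hG.2 x hx y hy).2
    clear hxy hy
    induction this with
    | refl => exact Relation.ReflTransGen.refl
    | tail _ hbc ih =>
      obtain ⟨e, he⟩ := hbc
      exact h e _ _ he ih
  have heS : e ∉ S := fun he => hw (Relation.ReflTransGen.tail hu ⟨e, he, hl⟩)
  obtain ⟨F, ⟨hF, hFO⟩, rfl⟩ : e ∈ D.dual.searchTreeEdges O up := by
    by_contra h
    exact heS ⟨hl.edge_mem, h⟩
  have hc := (acyclicOn_of_isSearchTree hV hE hO hT).coboundaryOnto (hE.subset sdiff_subset)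
    sdiff_subset
  have hc' := hc.insert (A := {z | G.ReachableOn S x z})
      (fun e he u w hl hu => mem_of_adjOn_reachableOn he hl hu) hl.symm hw hu
  obtain ⟨e, he, h | h, -⟩ := exists_isLink_descendants hV hE hO hT
    (insert_subset hl.edge_mem sdiff_subset) hc' hF hFO
  · exact he.2 (Or.inl h)
  · exact he.2 (Or.inr ⟨he.1, h⟩)

/-- An edge g ≠ e of the cut is some `up H`. After exchanging e for g the edge set still does not
separate the plane, so there is a way out of the descendants of H; the only edge left for it is e.
Hence exactly one of the faces at e descends from H. -/
theorem congestionSet_subset (hV : V(G).Finite) (hE : E(G).Finite) (hO : D.IsFace O)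
    (hT : D.dual.IsSearchTree O up par) (he : e ∈ E(G) \ D.dual.searchTreeEdges O up)
    (hl : D.dual.IsLink e F F') :
    G.congestionSet (G.restrict (E(G) \ D.dual.searchTreeEdges O up)) e ⊆
      insert e (up '' {H | H ∈ ancestors O par F ∪ ancestors O par F' ∧ F ≠ F'}) := by
  intro g hg
  by_cases hge : g = e
  · exact Or.inl hge
  right
  have ha := acyclicOn_of_isSearchTree hV hE hO hT
  obtain ⟨hgS, hc⟩ := coboundaryOnto_exchange (hE.subset sdiff_subset) sdiff_subset ha he hg hge
  obtain ⟨H, ⟨hH, hHO⟩, rfl⟩ : g ∈ D.dual.searchTreeEdges O up := by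
    by_contra h
    exact hgS.2 ⟨hgS.1, h⟩
  refine ⟨H, ?_, rfl⟩
  obtain ⟨e', he', h, K, K', hK, hKd, hKd'⟩ := exists_isLink_descendants hV hE hO hT
    (insert_subset hgS.1 (sdiff_subset.trans sdiff_subset)) hc hH hHO
  have hee : e' = e := by
    by_contra hne
    rcases h with h | h
    · exact he'.2 (Or.inl h)
    · exact he'.2 (Or.inr ⟨⟨he'.1, h⟩, hne⟩)
  subst hee
  have hKK : K ≠ K' := fun h => hKd' (h ▸ hKd)
  rcases hK.eq_and_eq_or_eq_and_eq hl with ⟨rfl, rfl⟩ | ⟨rfl, rfl⟩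
  · exact ⟨Or.inl ⟨hHO, hKd⟩, hKK⟩
  · exact ⟨Or.inr ⟨hHO, hKd⟩, hKK.symm⟩

theorem encard_congestionSet_le (hV : V(G).Finite) (hE : E(G).Finite) (hO : D.IsExteriorFace O)
    (hT : D.dual.IsSearchTree O up par) (he : e ∈ E(G) \ D.dual.searchTreeEdges O up) :
    (G.congestionSet (G.restrict (E(G) \ D.dual.searchTreeEdges O up)) e).encard ≤
      D.maxIndexSum + 1 := by
  obtain ⟨F, F', hl⟩ := exists_dual_isLink (D := D) hV hE he.1
  refine (encard_le_encard (congestionSet_subset hV hE hO.1 hT he hl)).trans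
    ((encard_insert_le _ _).trans ?_)
  gcongr
  refine (encard_image_le _ _).trans ?_
  -- If e has the same face on both sides, only e itself crosses its cut, so the bound holds even
  -- when there are no adjacent faces.
  by_cases hne : F = F'
  · simp [hne]
  have hw := exists_hasWalk_dual (D := D) hV hE hO.1
  calc _ ≤ (ancestors O par F ∪ ancestors O par F').encard := encard_le_encard fun H hH => hH.1
    _ ≤ (ancestors O par F).encard + (ancestors O par F').encard := encard_union_le _ _
    _ ≤ D.absoluteIndex F + D.absoluteIndex F' :=
      add_le_add ((hT.encard_ancestors_le hw hl.2.1).trans (level_le_absoluteIndex hV hE hO))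
        ((hT.encard_ancestors_le hw hl.2.2.1).trans (level_le_absoluteIndex hV hE hO))
    _ ≤ D.maxIndexSum := absoluteIndex_add_le_maxIndexSum (areAdjacentFaces_of_isLink hl hne)

end SearchTree

theorem spanningTreeCongestion_le (hV : V(G).Finite) (hE : E(G).Finite) (hG : G.IsConnected)
    (D : PlaneDrawing G) : G.spanningTreeCongestion ≤ D.maxIndexSum + 1 := by
  -- Without edge labels there is no value for `up` at the root; in that case G is its own spanning
  -- tree, with congestion 0.
  rcases isEmpty_or_nonempty β with hβ | hβ
  · refine iInf₂_le_of_le G ⟨IsSpanningSubgraph.rfl, hG, fun n v f _ => hβ.elim (f 0)⟩ ?_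
    exact iSup₂_le fun e _ => hβ.elim e
  obtain ⟨O, hO⟩ := exists_isExteriorFace (D := D) hV hE
  obtain ⟨up, par, hT⟩ := exists_isSearchTree (exists_hasWalk_dual (D := D) hV hE hO.1)
  refine iInf₂_le_of_le _ (isSpanningTree_restrict hG.1
    (fun x hx y hy => reachableOn_of_isSearchTree hV hE hG hO.1 hT hx hy)
    (acyclicOn_of_isSearchTree hV hE hO.1 hT)) ?_
  refine iSup₂_le fun e he => encard_congestionSet_le hV hE hO hT ?_
  rw [edgeSet_restrict] at he
  exact he.2

end PlaneDrawing

end Graph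

end

theorem proposition2 {α β : Type*} (G : Graph α β) (hV : V(G).Finite) (hE : E(G).Finite)
    (hG : G.IsConnected) (D : G.PlaneDrawing) :
    D.maxIndexSum < ⊤ ∧ G.spanningTreeCongestion ≤ D.maxIndexSum + 1 :=
  ⟨Graph.PlaneDrawing.maxIndexSum_lt_top hV hE,
    Graph.PlaneDrawing.spanningTreeCongestion_le hV hE hG D⟩
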